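/- Let $d\ge 1$, $\alpha_i\in(1,2)$, $d_{i,+},d_{i,-}\ge 0$ with $d_{i,+}+d_{i,-}>0$ $(1\le i\le d)$, and put $$\mu:=\max_{1\le i\le d}\frac{|d_{i,+}-d_{i,-}|}{d_{i,+}+d_{i,-}}\,\Bigl|\tan\bigl(\tfrac{\alpha_i}{2}\pi\bigr)\Bigr|.$$ For a mesh, that is, a box $\prod_{i=1}^d(a_i,b_i)$ with $a_i<b_i$, integers $n_1,\dots,n_d\ge 1$ and a time step $\delta>0$, put $\nu=1/\delta$, $n=n_1\cdots n_d$, $h_i=(b_i-a_i)/(n_i+1)$, $v_{i,\pm}=d_{i,\pm}/(2h_i^{\alpha_i})$. For $\alpha\in(1,2)$ let $g_0^{(\alpha)}=1$, $g_k^{(\alpha)}=\bigl(1-\frac{\alpha+1}{k}\bigr)g_{k-1}^{(\alpha)}$, $w_0^{(\alpha)}=\frac{\alpha}{2}g_0^{(\alpha)}$, $w_k^{(\alpha)}=\frac{\alpha}{2}g_k^{(\alpha)}+\frac{2-\alpha}{2}g_{k-1}^{(\alpha)}$ $(k\ge1)$, and let $L_m^{(\alpha)}\in\mathbb R^{m\times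 m}$ be the Toeplitz matrix with $(j,k)$ entry $-w_{j-k+1}^{(\alpha)}$ if $k\le j+1$ and $0$ otherwise. For a symmetric Toeplitz matrix $T$ with first column $(t_1,\dots,t_m)^\top$ let $\tau(T)=T-H$, where $H$ is the $m\times m$ Hankel matrix with first column $(t_3,\dots,t_m,0,0)^\top$ and last column $(0,0,t_m,\dots,t_3)^\top$ ($H=0$ if $m\le2$); write $\mathcal H(Z)=\frac12(Z+Z^\top)$, and let $Y_m$ be the $m\times m$ matrix with ones on the anti-diagonal and zeros elsewhere. With $W_i=I_{n_1\cdots n_{i-1}}\otimes L_{n_i}^{(\alpha_i)}\otimes I_{n_{i+1}\cdots n_d}$ define $$A_n=\nu I_n+\sum_{i=1}^d\bigl(v_{i,+}W_i+v_{i,-}W_i^\top\bigr),\qquad P_n=\nu I_n+\sum_{i=1}^d(v_{i,+}+v_{i,-})\,I_{n_1\cdots n_{i-1}}\otimes\tau\bigl(\mathcal H(L_{n_i}^{(\alpha_i)})\bigr)\otimes I_{n_{i+1}\cdots n_d},$$ and $Y_n=Y_{n_1}\otimes\cdots\otimes Y_{n_d}$. For $\varepsilon\in\mathbb R$ let $$J_\varepsilon=\Bigl(-\tfrac32(1+\varepsilon),-\tfrac12\Bigr)\cup\Bigl(\tfrac12,\tfrac32(1+\varepsilon)\Bigr).$$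 1. For every mesh, $P_n$ is invertible and there is $\varepsilon<\mu$ such that all eigenvalues of $P_n^{-1}Y_nA_n$ are real and lie in $J_\varepsilon$. 2. The bound does not depend on the mesh: there is $\varepsilon\ge 0$, depending only on $d$, the $\alpha_i$ and the $d_{i,\pm}$, with $\varepsilon<\mu$ if $\mu>0$ and $\varepsilon=0$ if $\mu=0$, such that for every mesh all eigenvalues of $P_n^{-1}Y_nA_n$ lie in $J_\varepsilon$. -/

import Mathlib

namespace FracTau

/-- The Grünwald coefficients `g_0 = 1`, `g_k = (1 - (α + 1) / k) g_{k-1}` for `k ≥ 1`. -/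
noncomputable def grunwaldCoeff (α : ℝ) : ℕ → ℝ
  | 0 => 1
  | k + 1 => (1 - (α + 1) / ((k : ℝ) + 1)) * grunwaldCoeff α k

/-- The weighted and shifted Grünwald coefficients
`w_0 = (α / 2) g_0`, `w_k = (α / 2) g_k + ((2 - α) / 2) g_{k-1}` for `k ≥ 1`. -/
noncomputable def wsgCoeff (α : ℝ) : ℕ → ℝ
  | 0 => α / 2 * grunwaldCoeff α 0
  | k + 1 => α / 2 * grunwaldCoeff α (k + 1) + (2 - α) / 2 * grunwaldCoeff α k

/-- The `m × m` lower Hessenberg Toeplitz matrix `L_m^{(α)}`: its `(j, k)` entry is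
`-w_{j-k+1}` if `k ≤ j + 1`, and `0` otherwise. -/
noncomputable def grunwaldMatrix (α : ℝ) (m : ℕ) : Matrix (Fin m) (Fin m) ℝ :=
  Matrix.of fun j k =>
    if (k : ℕ) ≤ (j : ℕ) + 1 then -wsgCoeff α ((j : ℕ) + 1 - (k : ℕ)) else 0

/-- The symmetric part `(Z + Zᵀ) / 2` of a real square matrix. -/
noncomputable def symPart {ι : Type*} (Z : Matrix ι ι ℝ) : Matrix ι ι ℝ :=
  (1 / 2 : ℝ) • (Z + Z.transpose)

/-- The first column of `T`, indexed from `0` and extended by zero. With `t_1, …, t_m` the entries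
of that column, `firstColumn T k = t_{k+1}`. -/
def firstColumn {m : ℕ} (T : Matrix (Fin m) (Fin m) ℝ) (k : ℕ) : ℝ :=
  if h : k < m then T ⟨k, h⟩ ⟨0, Nat.zero_lt_of_lt h⟩ else 0

/-- The `m × m` Hankel matrix with first column `(t_3, t_4, …, t_m, 0, 0)` and last column
`(0, 0, t_m, …, t_4, t_3)`, where `(t_1, …, t_m)` is the first column of `T`. Rows and columns are
indexed from `0`, so the entry depends on `i + j ∈ {0, …, 2 m - 2}`. -/
def hankelCorrection {m : ℕ} (T : Matrix (Fin m) (Fin m) ℝ) : Matrix (Fin m) (Fin m) ℝ :=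
  Matrix.of fun i j =>
    if (i : ℕ) + j + 2 < m then firstColumn T ((i : ℕ) + j + 2)
    else if m + 1 ≤ (i : ℕ) + j then firstColumn T (2 * m - ((i : ℕ) + j))
    else 0

/-- The Tau approximation `τ(T) = T - H` of a symmetric Toeplitz matrix `T`. -/
def tauMatrix {m : ℕ} (T : Matrix (Fin m) (Fin m) ℝ) : Matrix (Fin m) (Fin m) ℝ :=
  T - hankelCorrection T

/-- The multi-indices of the `n_1 × ⋯ × n_d` grid; there are `n_1 ⋯ n_d` of them. -/
abbrev MultiIndex {d : ℕ} (n : Fin d → ℕ) : Type := (i : Fin d) → Fin (n i)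

/-- The Kronecker product `M_1 ⊗ ⋯ ⊗ M_d`, with rows and columns labelled by multi-indices
(instead of by their position in the lexicographic order). -/
def kroneckerProd {d : ℕ} {n : Fin d → ℕ} (M : (i : Fin d) → Matrix (Fin (n i)) (Fin (n i)) ℝ) :
    Matrix (MultiIndex n) (MultiIndex n) ℝ :=
  Matrix.of fun p q => ∏ i, M i (p i) (q i)

/-- `I ⊗ ⋯ ⊗ I ⊗ M ⊗ I ⊗ ⋯ ⊗ I` with `M` in position `i`. -/
def inDirection {d : ℕ} {n : Fin d → ℕ} (i : Fin d) (M : Matrix (Fin (n i)) (Fin (n i)) ℝ) :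
    Matrix (MultiIndex n) (MultiIndex n) ℝ :=
  kroneckerProd (Function.update (fun j => (1 : Matrix (Fin (n j)) (Fin (n j)) ℝ)) i M)

/-- The `m × m` anti-identity (exchange) matrix: entry `1` where, counting from `0`,
`j + k = m - 1`, and `0` elsewhere. -/
def exchangeMatrix (m : ℕ) : Matrix (Fin m) (Fin m) ℝ :=
  Matrix.of fun j k => if (j : ℕ) + k + 1 = m then 1 else 0

/-- `Y_n = Y_{n_1} ⊗ ⋯ ⊗ Y_{n_d}`. -/
def multilevelExchange {d : ℕ} (n : Fin d → ℕ) : Matrix (MultiIndex n) (MultiIndex n) ℝ :=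
  kroneckerProd fun i => exchangeMatrix (n i)

/-- The spatial step size `h_i = (b_i - a_i) / (n_i + 1)`. -/
noncomputable def stepSize {d : ℕ} (a b : Fin d → ℝ) (n : Fin d → ℕ) (i : Fin d) : ℝ :=
  (b i - a i) / ((n i : ℝ) + 1)

/-- The scaled diffusion coefficient `v_i = c_i / (2 h_i ^ α_i)`. -/
noncomputable def scaledCoeff {d : ℕ} (α c a b : Fin d → ℝ) (n : Fin d → ℕ) (i : Fin d) : ℝ :=
  c i / (2 * stepSize a b n i ^ α i)

/-- The Crank–Nicolson / weighted and shifted Grünwald coefficient matrix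
`A_n = (1 / δ) I + ∑_i (v_{i,+} W_i + v_{i,-} W_iᵀ)`, `W_i = I ⊗ L_{n_i}^{(α_i)} ⊗ I`, for the
diffusion coefficients `dp = (d_{i,+})`, `dm = (d_{i,-})`, the box `∏ (a_i, b_i)`, the grid `n` and
the time step `δ`. -/
noncomputable def coeffMatrix {d : ℕ} (α dp dm a b : Fin d → ℝ) (n : Fin d → ℕ) (δ : ℝ) :
    Matrix (MultiIndex n) (MultiIndex n) ℝ :=
  (1 / δ) • (1 : Matrix (MultiIndex n) (MultiIndex n) ℝ) +
    ∑ i, (scaledCoeff α dp a b n i • inDirection i (grunwaldMatrix (α i) (n i)) +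
      scaledCoeff α dm a b n i • (inDirection i (grunwaldMatrix (α i) (n i))).transpose)

/-- The multilevel Tau preconditioner
`P_n = (1 / δ) I + ∑_i (v_{i,+} + v_{i,-}) I ⊗ τ(H(L_{n_i}^{(α_i)})) ⊗ I`, with `H` the symmetric
part. -/
noncomputable def tauPreconditioner {d : ℕ} (α dp dm a b : Fin d → ℝ) (n : Fin d → ℕ) (δ : ℝ) :
    Matrix (MultiIndex n) (MultiIndex n) ℝ :=
  (1 / δ) • (1 : Matrix (MultiIndex n) (MultiIndex n) ℝ) +
    ∑ i, (scaledCoeff α dp a b n i + scaledCoeff α dm a b n i) •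
      inDirection i (tauMatrix (symPart (grunwaldMatrix (α i) (n i))))

/-- The preconditioned symmetrized matrix `P_n⁻¹ Y_n A_n`. -/
noncomputable def preconditionedMatrix {d : ℕ} (α dp dm a b : Fin d → ℝ) (n : Fin d → ℕ) (δ : ℝ) :
    Matrix (MultiIndex n) (MultiIndex n) ℝ :=
  (tauPreconditioner α dp dm a b n δ)⁻¹ * (multilevelExchange n * coeffMatrix α dp dm a b n δ)

/-- `max_i |d_{i,+} - d_{i,-}| / (d_{i,+} + d_{i,-}) * |tan (α_i π / 2)|`. -/
noncomputable def epsBound {d : ℕ} [NeZero d] (α dp dm : Fin d → ℝ) : ℝ :=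
  Finset.univ.sup' Finset.univ_nonempty fun i : Fin d =>
    |dp i - dm i| / (dp i + dm i) * |Real.tan (α i / 2 * Real.pi)|

/-- All complex eigenvalues of the real matrix `X` are real and lie in `S`. -/
def EigenvaluesIn {ι : Type*} [Fintype ι] [DecidableEq ι] (X : Matrix ι ι ℝ) (S : Set ℝ) : Prop :=
  ∀ z : ℂ, Module.End.HasEigenvalue (Matrix.toLin' (X.map Complex.ofReal)) z →
    ∃ x ∈ S, (x : ℂ) = z

/-- The set `(-(3/2)(1+ε), -1/2) ∪ (1/2, (3/2)(1+ε))`. -/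
def spectralSet (ε : ℝ) : Set ℝ :=
  Set.Ioo (-(3 / 2 * (1 + ε))) (-(1 / 2)) ∪ Set.Ioo (1 / 2) (3 / 2 * (1 + ε))

end FracTau

/-! Write A, P, Y for the coefficient matrix, the preconditioner and the index reversal. The
Toeplitz structure gives YAY = Aᵀ and YPY = P, so YA is symmetric. As P is positive definite, every
eigenvalue is a real number a with Ax = aPy, y = Yx, for some real x ≠ 0.

Testing with x gives xᵀAx = a xᵀPy ≤ |a| xᵀPx by Cauchy–Schwarz, so |a| > 1/2 follows from xᵀPx <
2xᵀAx. Testing with y gives yᵀAx = a xᵀPx. If the skew part of A is bounded by μ times its symmetric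
part, then (yᵀAx)² ≤ (1 + μ²)(xᵀAx)(yᵀAy) (`sq_dotProduct_mulVec_le_of_sector`). Together with 2xᵀAx
< 3xᵀPx this yields |a| < (3/2)√(1 + μ²), so ε = √(1 + μ²) - 1 works on every mesh.

Two one-dimensional facts feed this argument. With T the symmetric part of L_m and H its Hankel
correction, T + H and T - 3H are diagonally dominant, which means τ(T) ≤ 2T ≤ 3τ(T). The symbol of
L_m takes its values in the sector |Im| ≤ |tan(απ/2)| Re, hence so does its numerical range
(`grunwaldMatrix_sector`). Both facts extend to d dimensions by summing over grid lines, and the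
step sizes cancel in the ratio of skew to symmetric part. -/

namespace FracTau

/-! ### Signs, monotonicity and partial sums of the coefficients -/

theorem grunwaldCoeff_succ_mul (α : ℝ) (k : ℕ) :
    ((k : ℝ) + 1) * grunwaldCoeff α (k + 1) = (k - α) * grunwaldCoeff α k := by
  have : (k : ℝ) + 1 ≠ 0 := by positivity
  rw [grunwaldCoeff]
  field_simp
  ring

theorem grunwaldCoeff_one (α : ℝ) : grunwaldCoeff α 1 = -α := by
  simp [grunwaldCoeff]

theorem grunwaldCoeff_two (α : ℝ) : grunwaldCoeff α 2 = α * (α - 1) / 2 := by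
  simp [grunwaldCoeff]
  ring

theorem grunwaldCoeff_nonneg {α : ℝ} (h1 : 1 < α) (h2 : α < 2) (k : ℕ) :
    0 ≤ grunwaldCoeff α (k + 2) := by
  induction k with
  | zero =>
    rw [zero_add, grunwaldCoeff_two]
    have := sub_pos.2 h1
    positivity
  | succ k ih =>
    rw [grunwaldCoeff]
    refine mul_nonneg ?_ ih
    push_cast
    rw [sub_nonneg, div_le_one (by positivity)]
    have : (0 : ℝ) ≤ k := by positivity
    linarith

theorem grunwaldCoeff_succ_le {α : ℝ} (h1 : 1 < α) (h2 : α < 2) (k : ℕ) :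
    grunwaldCoeff α (k + 3) ≤ grunwaldCoeff α (k + 2) := by
  rw [grunwaldCoeff]
  refine mul_le_of_le_one_left (grunwaldCoeff_nonneg h1 h2 k) ?_
  have : 0 ≤ (α + 1) / (((k + 2 : ℕ) : ℝ) + 1) := by positivity
  linarith

theorem sum_grunwaldCoeff {α : ℝ} (h : α ≠ 0) (N : ℕ) :
    ∑ k ∈ Finset.range (N + 1), grunwaldCoeff α k =
      -(((N : ℝ) + 1) / α * grunwaldCoeff α (N + 1)) := by
  induction N with
  | zero => simp [grunwaldCoeff, h]
  | succ N ih =>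
    rw [Finset.sum_range_succ, ih]
    have := grunwaldCoeff_succ_mul α (N + 1)
    field_simp
    push_cast at this ⊢
    linarith

theorem sum_grunwaldCoeff_nonpos {α : ℝ} (h1 : 1 < α) (h2 : α < 2) (N : ℕ) :
    ∑ k ∈ Finset.range (N + 2), grunwaldCoeff α k ≤ 0 := by
  rw [sum_grunwaldCoeff (by linarith), neg_nonpos]
  exact mul_nonneg (by positivity) (grunwaldCoeff_nonneg h1 h2 N)

/-- From index 2 on the coefficients are nonnegative. All partial sums with at least two terms are
nonpositive and g_0 + g_1 = 1 - α, so the tail sums stay below α - 1. -/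
theorem summable_abs_grunwaldCoeff {α : ℝ} (h1 : 1 < α) (h2 : α < 2) :
    Summable fun k => |grunwaldCoeff α k| := by
  rw [← summable_nat_add_iff 2]
  simp_rw [abs_of_nonneg (grunwaldCoeff_nonneg h1 h2 _)]
  refine summable_of_sum_range_le (c := α - 1) (grunwaldCoeff_nonneg h1 h2) fun n => ?_
  have := sum_grunwaldCoeff_nonpos h1 h2 n
  rw [Finset.sum_range_succ', Finset.sum_range_succ', zero_add, grunwaldCoeff_one] at this
  simp only [grunwaldCoeff] at this ⊢
  linarith

theorem wsgCoeff_nonneg {α : ℝ} (h1 : 1 < α) (h2 : α < 2) (k : ℕ) :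
    0 ≤ wsgCoeff α (k + 3) := by
  have := grunwaldCoeff_nonneg h1 h2 (k + 1)
  have := grunwaldCoeff_nonneg h1 h2 k
  have := sub_nonneg.2 h2.le
  rw [wsgCoeff]
  positivity

theorem wsgCoeff_succ_le {α : ℝ} (h1 : 1 < α) (h2 : α < 2) (k : ℕ) :
    wsgCoeff α (k + 4) ≤ wsgCoeff α (k + 3) := by
  have h3 := grunwaldCoeff_succ_le h1 h2 (k + 1)
  have h4 := grunwaldCoeff_succ_le h1 h2 k
  rw [wsgCoeff, wsgCoeff]
  gcongr

/-- For α near 1 the coefficient w_2 is negative, so only the sum w_0 + w_2, which occurs next to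
the diagonal of the symmetric part, can dominate w_3. -/
theorem wsgCoeff_three_le {α : ℝ} (h1 : 1 < α) :
    wsgCoeff α 3 ≤ wsgCoeff α 0 + wsgCoeff α 2 := by
  have h : wsgCoeff α 0 + wsgCoeff α 2 - wsgCoeff α 3 = α ^ 2 * (α - 1) * (α + 4) / 12 := by
    simp [wsgCoeff, grunwaldCoeff]
    ring
  have : 0 ≤ α ^ 2 * (α - 1) * (α + 4) / 12 := by
    have := sub_pos.2 h1
    positivity
  linarith

theorem sum_wsgCoeff_nonpos {α : ℝ} (h1 : 1 < α) (h2 : α < 2) (N : ℕ) :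
    ∑ k ∈ Finset.range (N + 3), wsgCoeff α k ≤ 0 := by
  rw [Finset.sum_range_succ']
  simp only [wsgCoeff]
  rw [Finset.sum_add_distrib, ← Finset.mul_sum, ← Finset.mul_sum]
  have e := sum_grunwaldCoeff_nonpos h1 h2 (N + 1)
  rw [Finset.sum_range_succ'] at e
  have e' := sum_grunwaldCoeff_nonpos h1 h2 N
  nlinarith

/-! ### The generating function (1 - z)^α up to the unit circle -/

theorem grunwaldCoeff_eq_choose (α : ℝ) (k : ℕ) :
    (grunwaldCoeff α k : ℂ) = (-1) ^ k * Ring.choose (α : ℂ) k := by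
  suffices grunwaldCoeff α k = (-1) ^ k * Ring.choose α k by
    rw [← Complex.ofReal_choose, this]
    push_cast
    rfl
  induction k with
  | zero => simp [grunwaldCoeff]
  | succ k ih =>
    have h := grunwaldCoeff_succ_mul α k
    have h0 : (k : ℝ) + 1 ≠ 0 := by positivity
    have h3 : ((k : ℝ) + 1) * Ring.choose α (k + 1) = (α - k) * Ring.choose α k := by
      rw [Ring.choose_eq_smul, Ring.choose_eq_smul, descPochhammer_succ_right]
      simp only [Polynomial.smeval_mul, Polynomial.smeval_sub, Polynomial.smeval_X, pow_one,
        Polynomial.smeval_natCast, pow_zero, nsmul_eq_mul, mul_one, smul_eq_mul, Nat.factorial_succ,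
        Nat.cast_mul, Nat.cast_succ]
      field_simp
    apply mul_left_cancel₀ h0
    rw [h, ih, mul_left_comm _ _ (Ring.choose α (k+1)), h3]
    ring

/-- The generating function of the Grünwald coefficients. -/
noncomputable def grunwaldSeries (α : ℝ) (z : ℂ) : ℂ := ∑' k, (grunwaldCoeff α k : ℂ) * z ^ k

theorem grunwaldSeries_of_norm_lt_one (α : ℝ) {z : ℂ} (hz : ‖z‖ < 1) :
    grunwaldSeries α z = (1 - z) ^ (α : ℂ) := by
  have h := (Complex.one_add_cpow_hasFPowerSeriesOnBall_zero (a := α)).hasSum (y := -z)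
    (by simpa [← ofReal_norm] using hz)
  rw [grunwaldSeries, HasSum.tsum_eq]
  convert! h using 1
  · ext k
    rw [grunwaldCoeff_eq_choose, binomialSeries_apply]
    simp [neg_pow z k]
    ring
  · simp [sub_eq_add_neg]

theorem norm_grunwaldCoeff_mul_pow_le (α : ℝ) {z : ℂ} (hz : ‖z‖ ≤ 1) (k : ℕ) :
    ‖(grunwaldCoeff α k : ℂ) * z ^ k‖ ≤ |grunwaldCoeff α k| := by
  rw [norm_mul, norm_pow, Complex.norm_real, Real.norm_eq_abs]
  exact mul_le_of_le_one_right (abs_nonneg _) (pow_le_one₀ (norm_nonneg _) hz)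

theorem continuousOn_grunwaldSeries {α : ℝ} (h1 : 1 < α) (h2 : α < 2) :
    ContinuousOn (grunwaldSeries α) (Metric.closedBall 0 1) :=
  continuousOn_tsum (fun k => by fun_prop) (summable_abs_grunwaldCoeff h1 h2)
    fun k z hz => norm_grunwaldCoeff_mul_pow_le α (by simpa using hz) k

/-- Both sides are limits along the radius rz, r → 1 from below: the series by uniform convergence
on the closed disc, the power by continuity off the branch cut. -/
theorem grunwaldSeries_of_norm_eq_one {α : ℝ} (h1 : 1 < α) (h2 : α < 2) {z : ℂ} (hz : ‖z‖ = 1)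
    (hz1 : 1 - z ∈ Complex.slitPlane) : grunwaldSeries α z = (1 - z) ^ (α : ℂ) := by
  have hu : Filter.Tendsto (fun r : ℝ => (r : ℂ) * z) (nhdsWithin 1 (Set.Ico 0 1)) (nhds z) := by
    have : Continuous fun r : ℝ => (r : ℂ) * z := by fun_prop
    simpa using (this.tendsto 1).mono_left nhdsWithin_le_nhds
  have hne : (nhdsWithin (1 : ℝ) (Set.Ico 0 1)).NeBot := by
    rw [← mem_closure_iff_nhdsWithin_neBot, closure_Ico (by norm_num)]
    simp
  have hr : ∀ᶠ r : ℝ in nhdsWithin 1 (Set.Ico 0 1), ‖(r : ℂ) * z‖ < 1 := by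
    filter_upwards [self_mem_nhdsWithin] with r hr
    simpa [hz, abs_of_nonneg hr.1] using hr.2
  have ht1 : Filter.Tendsto (fun r : ℝ => grunwaldSeries α ((r : ℂ) * z))
      (nhdsWithin 1 (Set.Ico 0 1)) (nhds (grunwaldSeries α z)) := by
    refine (continuousOn_grunwaldSeries h1 h2 z (by simp [hz])).tendsto.comp
      (tendsto_nhdsWithin_of_tendsto_nhds_of_eventually_within _ hu ?_)
    filter_upwards [hr] with r hr
    simpa using hr.le
  have ht2 : Filter.Tendsto (fun r : ℝ => (1 - (r : ℂ) * z) ^ (α : ℂ))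
      (nhdsWithin 1 (Set.Ico 0 1)) (nhds ((1 - z) ^ (α : ℂ))) :=
    (continuousAt_cpow_const hz1).tendsto.comp (hu.const_sub 1)
  refine tendsto_nhds_unique ht1 (ht2.congr' ?_)
  filter_upwards [hr] with r hr
  exact (grunwaldSeries_of_norm_lt_one α hr).symm

/-! ### The sector containing the values of the symbol -/

/-- This is tan(βv) ≤ β tan v, the convexity of tan, cleared of denominators so that v = π/2 is
allowed. The difference of the sides has derivative (1 - β²) sin v sin(βv) ≥ 0. -/
theorem cos_mul_sin_mul_le {β v : ℝ} (h0 : 0 < β) (h1 : β < 1) (hv : 0 ≤ v)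
    (hv' : v ≤ Real.pi / 2) :
    Real.cos v * Real.sin (β * v) ≤ β * (Real.sin v * Real.cos (β * v)) := by
  have hd : ∀ x : ℝ, HasDerivAt
      (fun v => β * (Real.sin v * Real.cos (β * v)) - Real.cos v * Real.sin (β * v))
      ((1 - β ^ 2) * (Real.sin x * Real.sin (β * x))) x := fun x => by
    have hl : HasDerivAt (fun v : ℝ => β * v) β x := by
      simpa using (hasDerivAt_id x).const_mul β
    convert! (((Real.hasDerivAt_sin x).mul hl.cos).const_mul β).sub
      ((Real.hasDerivAt_cos x).mul hl.sin) using 1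
    ring
  have hm : MonotoneOn
      (fun v => β * (Real.sin v * Real.cos (β * v)) - Real.cos v * Real.sin (β * v))
      (Set.Icc 0 (Real.pi / 2)) := by
    refine monotoneOn_of_deriv_nonneg (convex_Icc _ _)
      (fun x _ => (hd x).continuousAt.continuousWithinAt)
      (fun x _ => (hd x).differentiableAt.differentiableWithinAt) fun x hx => ?_
    rw [interior_Icc] at hx
    rw [(hd x).deriv]
    have hs : 0 ≤ Real.sin x :=
      Real.sin_nonneg_of_nonneg_of_le_pi hx.1.le (by linarith [hx.2, Real.pi_pos])
    have hs' : 0 ≤ Real.sin (β * x) :=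
      Real.sin_nonneg_of_nonneg_of_le_pi (mul_nonneg h0.le hx.1.le)
        (by nlinarith [hx.2, hx.1, Real.pi_pos])
    have : 0 ≤ 1 - β ^ 2 := by nlinarith
    positivity
  have := hm (Set.left_mem_Icc.2 (by positivity)) ⟨hv, hv'⟩ hv
  simp only [Real.sin_zero, mul_zero, zero_mul, Real.cos_zero, sub_zero] at this
  linarith

/-- The tangent inequality at u fixes the sign inside the absolute value. At π/2 - u, after
expanding the addition formulas, it is the bound itself. -/
theorem sector_bound_of_nonneg {β u : ℝ} (h0 : 0 < β) (h1 : β < 1) (hu : 0 ≤ u)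
    (hu' : u ≤ Real.pi / 2) :
    |Real.sin u * Real.cos (β * u) - β * (Real.cos u * Real.sin (β * u))| *
        Real.sin (β * (Real.pi / 2)) ≤
      Real.cos (β * (Real.pi / 2)) *
        (β * (Real.cos u * Real.cos (β * u)) + Real.sin u * Real.sin (β * u)) := by
  have k1 := cos_mul_sin_mul_le h0 h1 hu hu'
  have k2 := cos_mul_sin_mul_le h0 h1 (v := Real.pi / 2 - u) (by linarith) (by linarith)
  rw [Real.cos_pi_div_two_sub, Real.sin_pi_div_two_sub, mul_sub, Real.sin_sub, Real.cos_sub] at k2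
  have hs : 0 ≤ Real.sin u * Real.cos (β * u) := mul_nonneg
    (Real.sin_nonneg_of_nonneg_of_le_pi hu (by linarith [Real.pi_pos]))
    (Real.cos_nonneg_of_mem_Icc ⟨by nlinarith [Real.pi_pos], by nlinarith⟩)
  rw [abs_of_nonneg]
  · linarith
  · nlinarith [mul_le_mul_of_nonneg_left k1 h0.le,
      mul_nonneg hs (by nlinarith : (0 : ℝ) ≤ 1 - β * β)]

theorem sector_bound {β u : ℝ} (h0 : 0 < β) (h1 : β < 1) (hu : |u| ≤ Real.pi / 2) :
    |Real.sin u * Real.cos (β * u) - β * (Real.cos u * Real.sin (β * u))| *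
        Real.sin (β * (Real.pi / 2)) ≤
      Real.cos (β * (Real.pi / 2)) *
        (β * (Real.cos u * Real.cos (β * u)) + Real.sin u * Real.sin (β * u)) := by
  rcases le_total 0 u with h | h
  · exact sector_bound_of_nonneg h0 h1 h (by rwa [abs_of_nonneg h] at hu)
  · have := sector_bound_of_nonneg h0 h1 (neg_nonneg.2 h) (by rwa [abs_of_nonpos h] at hu)
    rw [mul_neg, Real.sin_neg, Real.sin_neg, Real.cos_neg, Real.cos_neg, neg_mul, mul_neg, mul_neg,
      neg_mul_neg, ← neg_sub', abs_neg] at this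
    exact this

theorem abs_tan_eq {α : ℝ} (h1 : 1 < α) (h2 : α < 2) :
    |Real.tan (α / 2 * Real.pi)| =
      Real.cos ((α - 1) * (Real.pi / 2)) / Real.sin ((α - 1) * (Real.pi / 2)) := by
  have e : α / 2 * Real.pi = (α - 1) * (Real.pi / 2) + Real.pi / 2 := by ring
  have hp := Real.pi_pos
  have hc : 0 < Real.cos ((α - 1) * (Real.pi / 2)) :=
    Real.cos_pos_of_mem_Ioo ⟨by nlinarith, by nlinarith⟩
  have hs : 0 < Real.sin ((α - 1) * (Real.pi / 2)) :=
    Real.sin_pos_of_pos_of_lt_pi (by nlinarith) (by nlinarith)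
  rw [e, Real.tan_eq_sin_div_cos, Real.sin_add_pi_div_two, Real.cos_add_pi_div_two, div_neg,
    abs_neg, abs_of_pos (div_pos hc hs)]

/-- The generating function `-∑ w_k e^{i(k-1)θ}` of the Toeplitz matrices `L_m^{(α)}`. -/
noncomputable def toeplitzSymbol (α θ : ℝ) : ℂ :=
  -(α / 2 * Complex.exp (-(θ * Complex.I)) + (2 - α) / 2) *
    grunwaldSeries α (Complex.exp (θ * Complex.I))

theorem continuous_toeplitzSymbol {α : ℝ} (h1 : 1 < α) (h2 : α < 2) :
    Continuous (toeplitzSymbol α) := by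
  unfold toeplitzSymbol
  refine Continuous.mul (by fun_prop) ?_
  exact (continuousOn_grunwaldSeries h1 h2).comp_continuous (by fun_prop)
    fun θ => by simp [Complex.norm_exp_ofReal_mul_I]

theorem one_sub_exp_eq {v : ℝ} (hv : 0 < Real.sin v) :
    1 - Complex.exp ((2 * v : ℝ) * Complex.I) =
      Complex.exp (Real.log (2 * Real.sin v) + (v - Real.pi / 2 : ℝ) * Complex.I) := by
  rw [Complex.exp_add, ← Complex.ofReal_exp, Real.exp_log (by positivity)]
  rw [Complex.exp_mul_I, Complex.exp_mul_I, ← Complex.ofReal_cos, ← Complex.ofReal_sin,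
    ← Complex.ofReal_cos, ← Complex.ofReal_sin, Real.cos_sub_pi_div_two, Real.sin_sub_pi_div_two,
    Real.cos_two_mul, Real.sin_two_mul, Real.cos_sq']
  push_cast
  ring

/-- With θ = π - 2u one has 1 - e^{iθ} = 2 cos u · e^{-iu} and e^{-iθ} = -e^{2iu}. The symbol
becomes (2 cos u)^α (β cos u + i sin u) e^{-iβu} with β = α - 1. -/
theorem toeplitzSymbol_eq {α : ℝ} (h1 : 1 < α) (h2 : α < 2) {u : ℝ} (hu : |u| < Real.pi / 2) :
    ∃ R : ℝ, 0 ≤ R ∧ toeplitzSymbol α (2 * (Real.pi / 2 - u)) =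
      R * (⟨(α - 1) * (Real.cos u * Real.cos ((α - 1) * u)) + Real.sin u * Real.sin ((α - 1) * u),
        Real.sin u * Real.cos ((α - 1) * u) - (α - 1) * (Real.cos u * Real.sin ((α - 1) * u))⟩
          : ℂ) := by
  rw [abs_lt] at hu
  have hp := Real.pi_pos
  have hsin : 0 < Real.sin (Real.pi / 2 - u) :=
    Real.sin_pos_of_pos_of_lt_pi (by linarith) (by linarith)
  have hexp := one_sub_exp_eq hsin
  set v := Real.pi / 2 - u with hv
  set ρ := Real.log (2 * Real.sin v)
  have hvu : v - Real.pi / 2 = -u := by simp [hv]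
  rw [hvu] at hexp
  -- The argument -u lies in (-π/2, π/2), so the principal logarithm returns the exponent.
  have hlog : Complex.log (1 - Complex.exp ((2 * v : ℝ) * Complex.I)) =
      ρ + (-u : ℝ) * Complex.I := by
    rw [hexp, Complex.log_exp] <;> simp <;> linarith
  have hne : 1 - Complex.exp ((2 * v : ℝ) * Complex.I) ≠ 0 := by
    rw [hexp]; exact Complex.exp_ne_zero _
  have hslit : 1 - Complex.exp ((2 * v : ℝ) * Complex.I) ∈ Complex.slitPlane := by
    rw [hexp, Complex.mem_slitPlane_iff]
    left
    rw [Complex.exp_re]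
    refine mul_pos (Real.exp_pos _) (Real.cos_pos_of_mem_Ioo ?_)
    simp
    constructor <;> linarith
  refine ⟨Real.exp (ρ * α), (Real.exp_pos _).le, ?_⟩
  rw [toeplitzSymbol, grunwaldSeries_of_norm_eq_one h1 h2 (Complex.norm_exp_ofReal_mul_I _) hslit,
    Complex.cpow_def_of_ne_zero hne, hlog]
  have e1 : ((ρ : ℂ) + (-u : ℝ) * Complex.I) * α =
      ((ρ * α : ℝ) : ℂ) + (((-u : ℝ) * Complex.I) + ((-((α - 1) * u) : ℝ) * Complex.I)) := by
    push_cast; ring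
  have e2 : Complex.exp (-(((2 * v : ℝ) : ℂ) * Complex.I)) =
      -(Complex.exp ((u : ℝ) * Complex.I) * Complex.exp ((u : ℝ) * Complex.I)) := by
    rw [← Complex.exp_add, ← Complex.exp_sub_pi_mul_I]
    congr 1
    rw [hv]
    push_cast
    ring
  have e3 : Complex.exp ((u : ℝ) * Complex.I) * Complex.exp ((-u : ℝ) * Complex.I) = 1 := by
    rw [← Complex.exp_add]
    simp
  have e4 : (α / 2 * Complex.exp ((u : ℝ) * Complex.I) -
      (2 - α) / 2 * Complex.exp ((-u : ℝ) * Complex.I)) * Complex.exp ((-((α - 1) * u) : ℝ) *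
        Complex.I) = ⟨(α - 1) * (Real.cos u * Real.cos ((α - 1) * u)) +
          Real.sin u * Real.sin ((α - 1) * u),
        Real.sin u * Real.cos ((α - 1) * u) - (α - 1) * (Real.cos u * Real.sin ((α - 1) * u))⟩ := by
    have e5 : (α / 2 * Complex.exp ((u : ℝ) * Complex.I) -
        (2 - α) / 2 * Complex.exp ((-u : ℝ) * Complex.I)) = ⟨(α - 1) * Real.cos u, Real.sin u⟩ := by
      rw [Complex.exp_mul_I, Complex.exp_mul_I, ← Complex.ofReal_cos, ← Complex.ofReal_sin,
        ← Complex.ofReal_cos, ← Complex.ofReal_sin, Real.cos_neg, Real.sin_neg, Complex.mk_eq_add_mul_I]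
      push_cast
      ring
    rw [e5, Complex.exp_mul_I, ← Complex.ofReal_cos, ← Complex.ofReal_sin, Real.cos_neg,
      Real.sin_neg]
    generalize Real.cos ((α - 1) * u) = c
    generalize Real.sin ((α - 1) * u) = s
    apply Complex.ext <;> simp <;> ring
  rw [← e4, e1, Complex.exp_add, Complex.exp_add, ← Complex.ofReal_exp, e2]
  linear_combination (Real.exp (ρ * α) : ℂ) * (α / 2) * Complex.exp ((u : ℝ) * Complex.I) *
    Complex.exp ((-((α - 1) * u) : ℝ) * Complex.I) * e3

theorem abs_im_toeplitzSymbol_le {α : ℝ} (h1 : 1 < α) (h2 : α < 2) {θ : ℝ}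
    (hθ : θ ∈ Set.Ioo 0 (2 * Real.pi)) :
    |(toeplitzSymbol α θ).im| ≤ |Real.tan (α / 2 * Real.pi)| * (toeplitzSymbol α θ).re := by
  have hp := Real.pi_pos
  have hs : 0 < Real.sin ((α - 1) * (Real.pi / 2)) :=
    Real.sin_pos_of_pos_of_lt_pi (by nlinarith) (by nlinarith)
  have hu : |Real.pi / 2 - θ / 2| < Real.pi / 2 := by
    rw [abs_lt]
    constructor <;> linarith [hθ.1, hθ.2]
  obtain ⟨R, hR, h⟩ := toeplitzSymbol_eq h1 h2 hu
  rw [show 2 * (Real.pi / 2 - (Real.pi / 2 - θ / 2)) = θ by ring] at h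
  rw [h, abs_tan_eq h1 h2, Complex.re_ofReal_mul, Complex.im_ofReal_mul, abs_mul, abs_of_nonneg hR,
    mul_left_comm (_ / _)]
  refine mul_le_mul_of_nonneg_left ?_ hR
  rw [div_mul_eq_mul_div, le_div_iff₀ hs]
  exact sector_bound (by linarith) (by linarith) hu.le

/-! ### Fourier coefficients of the symbol and the numerical range -/

open Complex in
theorem integral_exp_int_mul (l : ℤ) :
    ∫ θ in (0 : ℝ)..2 * Real.pi, exp (l * (θ * I)) = if l = 0 then 2 * (Real.pi : ℂ) else 0 := by
  split_ifs with h
  · simp [h]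
  · have hc : (l : ℂ) * I ≠ 0 := by simp [h]
    have := integral_exp_mul_complex (a := 0) (b := 2 * Real.pi) hc
    simp_rw [show ∀ θ : ℝ, (l : ℂ) * (θ * I) = l * I * θ by intro θ; ring]
    rw [this, show (l : ℂ) * I * ((2 * Real.pi : ℝ) : ℂ) = l * (2 * Real.pi * I) by
      push_cast; ring, exp_int_mul_two_pi_mul_I]
    simp

open Complex in
theorem integral_grunwaldSeries {α : ℝ} (h1 : 1 < α) (h2 : α < 2) (l : ℤ) :
    ∫ θ in (0 : ℝ)..2 * Real.pi, grunwaldSeries α (exp (θ * I)) * exp (-l * (θ * I)) =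
      2 * (Real.pi : ℂ) * if 0 ≤ l then (grunwaldCoeff α l.toNat : ℂ) else 0 := by
  let F : ℕ → C(ℝ, ℂ) := fun k =>
    ⟨fun θ => (grunwaldCoeff α k : ℂ) * exp (((k - l : ℤ) : ℂ) * (θ * I)), by fun_prop⟩
  have hF : ∀ k (θ : ℝ), F k θ = (grunwaldCoeff α k : ℂ) * exp (θ * I) ^ k * exp (-l * (θ * I)) :=
    fun k θ => by
      simp only [F, ContinuousMap.coe_mk]
      rw [mul_assoc, ← exp_nat_mul, ← exp_add]
      congr 2
      push_cast
      ring
  have hn : ∀ k (θ : ℝ), ‖F k θ‖ ≤ |grunwaldCoeff α k| := fun k θ => by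
    have : (((k - l : ℤ) : ℂ) * (θ * I)) = (((k - l : ℤ) : ℝ) * θ : ℝ) * I := by
      push_cast; ring
    simp only [F, ContinuousMap.coe_mk]
    rw [this, norm_mul, norm_exp_ofReal_mul_I, Complex.norm_real, Real.norm_eq_abs, mul_one]
  have hs := intervalIntegral.hasSum_intervalIntegral_of_summable_norm (a := 0)
    (b := 2 * Real.pi) (f := F) <|
    (summable_abs_grunwaldCoeff h1 h2).of_nonneg_of_le (fun _ => norm_nonneg _) fun k =>
      (ContinuousMap.norm_le _ (abs_nonneg _)).2 fun θ => hn k θ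
  have hL : ∀ θ : ℝ, ∑' k, F k θ = grunwaldSeries α (exp (θ * I)) * exp (-l * (θ * I)) := fun θ => by
    simp_rw [hF]
    rw [tsum_mul_right, grunwaldSeries]
  simp_rw [hL] at hs
  rw [← hs.tsum_eq]
  have hI : ∀ k, ∫ θ in (0 : ℝ)..2 * Real.pi, F k θ =
      if (k : ℤ) = l then 2 * (Real.pi : ℂ) * grunwaldCoeff α k else 0 := fun k => by
    simp only [F, ContinuousMap.coe_mk]
    rw [intervalIntegral.integral_const_mul, integral_exp_int_mul]
    simp only [sub_eq_zero]
    split_ifs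
    · ring
    · simp
  simp_rw [hI]
  split_ifs with h
  · rw [tsum_eq_single l.toNat]
    · rw [if_pos (Int.toNat_of_nonneg h)]
    · intro k hk
      rw [if_neg]
      rintro rfl
      simp at hk
  · rw [mul_zero]
    convert tsum_zero with k
    rw [if_neg]
    omega

open Complex in
theorem integral_toeplitzSymbol {α : ℝ} (h1 : 1 < α) (h2 : α < 2) {m : ℕ} (j k : Fin m) :
    ∫ θ in (0 : ℝ)..2 * Real.pi, toeplitzSymbol α θ *
        (exp (-((j : ℕ) * (θ * I))) * exp ((k : ℕ) * (θ * I))) =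
      2 * (Real.pi : ℂ) * grunwaldMatrix α m j k := by
  have hG : Continuous fun θ : ℝ => grunwaldSeries α (exp (θ * I)) :=
    (continuousOn_grunwaldSeries h1 h2).comp_continuous (by fun_prop)
      fun θ => by simp [norm_exp_ofReal_mul_I]
  have e : ∀ θ : ℝ, toeplitzSymbol α θ *
        (exp (-((j : ℕ) * (θ * I))) * exp ((k : ℕ) * (θ * I))) =
      -(α / 2) * (grunwaldSeries α (exp (θ * I)) * exp (-((j - k + 1 : ℤ) : ℂ) * (θ * I))) -
      (2 - α) / 2 * (grunwaldSeries α (exp (θ * I)) * exp (-((j - k : ℤ) : ℂ) * (θ * I))) :=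
    fun θ => by
      have e1 : exp (-((j - k + 1 : ℤ) : ℂ) * (θ * I)) =
          exp (-(θ * I)) * exp (-((j - k : ℤ) : ℂ) * (θ * I)) := by
        rw [← exp_add]; congr 1; push_cast; ring
      have e2 : exp (-((j : ℕ) * (θ * I))) * exp ((k : ℕ) * (θ * I)) =
          exp (-((j - k : ℤ) : ℂ) * (θ * I)) := by
        rw [← exp_add]; congr 1; push_cast; ring
      rw [e1, e2, toeplitzSymbol]
      ring
  simp_rw [e]
  rw [intervalIntegral.integral_sub, intervalIntegral.integral_const_mul,
    intervalIntegral.integral_const_mul, integral_grunwaldSeries h1 h2, integral_grunwaldSeries h1 h2]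
  · simp only [grunwaldMatrix, Matrix.of_apply]
    rcases lt_trichotomy (k : ℕ) ((j : ℕ) + 1) with h | h | h
    · obtain ⟨l, hl⟩ : ∃ l, (j : ℕ) = k + l := ⟨j - k, by omega⟩
      rw [if_pos (by omega), if_pos (by omega), if_pos (by omega), hl,
        show ((k + l : ℕ) : ℤ) - k + 1 = ((l + 1 : ℕ) : ℤ) by push_cast; ring,
        show ((k + l : ℕ) : ℤ) - k = (l : ℤ) by push_cast; ring, Int.toNat_natCast, Int.toNat_natCast,
        show (k + l + 1 - k : ℕ) = l + 1 by omega, wsgCoeff]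
      push_cast
      ring
    · rw [if_pos (by omega), if_neg (by omega), if_pos (by omega), h]
      rw [show ((j : ℕ) : ℤ) - ((j + 1 : ℕ) : ℤ) + 1 = 0 by push_cast; ring]
      simp [wsgCoeff]
      ring
    · rw [if_neg (by omega), if_neg (by omega), if_neg (by omega)]
      simp
  all_goals
    apply Continuous.intervalIntegrable
    fun_prop

open Matrix

-- The quadratic form of a Toeplitz matrix is the mean of its symbol against |p|², p being the
-- trigonometric polynomial with coefficients z. For z = x + iy the real and imaginary parts of this
-- identity produce xᵀLx + yᵀLy and xᵀLy - yᵀLx.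
open Complex in
theorem integral_toeplitzSymbol_mul_normSq {α : ℝ} (h1 : 1 < α) (h2 : α < 2) {m : ℕ}
    (z : Fin m → ℂ) :
    ∫ θ in (0 : ℝ)..2 * Real.pi, toeplitzSymbol α θ *
        (normSq (∑ k : Fin m, z k * exp ((k : ℕ) * (θ * I))) : ℂ) =
      2 * (Real.pi : ℂ) *
        ∑ j, ∑ k, starRingEnd ℂ (z j) * z k * (grunwaldMatrix α m j k : ℂ) := by
  have hc := continuous_toeplitzSymbol h1 h2
  have e : ∀ θ : ℝ, toeplitzSymbol α θ *
        (normSq (∑ k : Fin m, z k * exp ((k : ℕ) * (θ * I))) : ℂ) =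
      ∑ j : Fin m, ∑ k : Fin m, starRingEnd ℂ (z j) * z k * (toeplitzSymbol α θ *
        (exp (-((j : ℕ) * (θ * I))) * exp ((k : ℕ) * (θ * I)))) := fun θ => by
    rw [normSq_eq_conj_mul_self, map_sum, Finset.sum_mul_sum, Finset.mul_sum]
    refine Finset.sum_congr rfl fun j _ => ?_
    rw [Finset.mul_sum]
    refine Finset.sum_congr rfl fun k _ => ?_
    rw [map_mul, ← exp_conj]
    simp only [map_mul, map_natCast, conj_ofReal, conj_I]
    rw [mul_neg, mul_neg]
    ring
  simp_rw [e]
  rw [intervalIntegral.integral_finsetSum fun j _ => by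
    apply Continuous.intervalIntegrable; fun_prop, Finset.mul_sum]
  refine Finset.sum_congr rfl fun j _ => ?_
  rw [intervalIntegral.integral_finsetSum fun j _ => by
    apply Continuous.intervalIntegrable; fun_prop, Finset.mul_sum]
  refine Finset.sum_congr rfl fun k _ => ?_
  rw [intervalIntegral.integral_const_mul, integral_toeplitzSymbol h1 h2]
  ring

/-- The numerical range of `L_m^{(α)}` lies in the sector `|Im| ≤ |tan (α π / 2)| Re`. -/
theorem grunwaldMatrix_sector {α : ℝ} (h1 : 1 < α) (h2 : α < 2) {m : ℕ} (x y : Fin m → ℝ) :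
    |x ⬝ᵥ grunwaldMatrix α m *ᵥ y - y ⬝ᵥ grunwaldMatrix α m *ᵥ x| ≤
      |Real.tan (α / 2 * Real.pi)| *
        (x ⬝ᵥ grunwaldMatrix α m *ᵥ x + y ⬝ᵥ grunwaldMatrix α m *ᵥ y) := by
  have hc := continuous_toeplitzSymbol h1 h2
  have hp := Real.pi_pos
  set N : ℝ → ℝ := fun θ =>
    Complex.normSq (∑ k : Fin m, (⟨x k, y k⟩ : ℂ) * Complex.exp ((k : ℕ) * (θ * Complex.I)))
  have hN : Continuous N := Complex.continuous_normSq.comp (by fun_prop)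
  have hN0 : ∀ θ, 0 ≤ N θ := fun θ => Complex.normSq_nonneg _
  have hI := integral_toeplitzSymbol_mul_normSq h1 h2 (fun k : Fin m => (⟨x k, y k⟩ : ℂ))
  have hint : IntervalIntegrable (fun θ => toeplitzSymbol α θ * (N θ : ℂ)) MeasureTheory.volume 0
      (2 * Real.pi) := by
    apply Continuous.intervalIntegrable; fun_prop
  have hre := Complex.reCLM.intervalIntegral_comp_comm hint
  have him := Complex.imCLM.intervalIntegral_comp_comm hint
  rw [hI] at hre him
  simp only [Complex.reCLM_apply, Complex.imCLM_apply, Complex.re_mul_ofReal,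
    Complex.im_mul_ofReal] at hre him
  have hre' : ∫ θ in (0 : ℝ)..2 * Real.pi, (toeplitzSymbol α θ).re * N θ =
      2 * Real.pi * (x ⬝ᵥ grunwaldMatrix α m *ᵥ x + y ⬝ᵥ grunwaldMatrix α m *ᵥ y) := by
    rw [hre, show (2 * (Real.pi : ℂ)) = ((2 * Real.pi : ℝ) : ℂ) by push_cast; rfl,
      Complex.re_ofReal_mul, Complex.re_sum]
    simp only [dotProduct, mulVec, Finset.mul_sum, ← Finset.sum_add_distrib, Complex.re_sum]
    refine Finset.sum_congr rfl fun j _ => Finset.sum_congr rfl fun k _ => ?_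
    simp
    ring
  have him' : ∫ θ in (0 : ℝ)..2 * Real.pi, (toeplitzSymbol α θ).im * N θ =
      2 * Real.pi * (x ⬝ᵥ grunwaldMatrix α m *ᵥ y - y ⬝ᵥ grunwaldMatrix α m *ᵥ x) := by
    rw [him, show (2 * (Real.pi : ℂ)) = ((2 * Real.pi : ℝ) : ℂ) by push_cast; rfl,
      Complex.im_ofReal_mul, Complex.im_sum]
    simp only [dotProduct, mulVec, Finset.mul_sum, ← Finset.sum_sub_distrib, Complex.im_sum]
    refine Finset.sum_congr rfl fun j _ => Finset.sum_congr rfl fun k _ => ?_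
    simp
    ring
  have hcre : Continuous fun θ => (toeplitzSymbol α θ).re := Complex.continuous_re.comp hc
  have hcim : Continuous fun θ => (toeplitzSymbol α θ).im := Complex.continuous_im.comp hc
  have key : |∫ θ in (0 : ℝ)..2 * Real.pi, (toeplitzSymbol α θ).im * N θ| ≤
      |Real.tan (α / 2 * Real.pi)| *
        ∫ θ in (0 : ℝ)..2 * Real.pi, (toeplitzSymbol α θ).re * N θ := by
    rw [← intervalIntegral.integral_const_mul]
    refine (intervalIntegral.abs_integral_le_integral_abs (by positivity)).trans ?_
    -- The open interval suffices; the formula for the symbol is not available at the endpoints,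
    -- where 1 - e^{iθ} = 0.
    refine intervalIntegral.integral_mono_on_of_le_Ioo (by positivity)
      (by apply Continuous.intervalIntegrable; fun_prop)
      (by apply Continuous.intervalIntegrable; fun_prop) fun θ hθ => ?_
    rw [abs_mul, abs_of_nonneg (hN0 θ), ← mul_assoc]
    exact mul_le_mul_of_nonneg_right (abs_im_toeplitzSymbol_le h1 h2 hθ) (hN0 θ)
  rw [hre', him', abs_mul, abs_of_pos (by positivity : 0 < 2 * Real.pi), mul_left_comm] at key
  exact le_of_mul_le_mul_left key (by positivity)

/-! ### Diagonal dominance and the comparison of T with τ(T) -/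

/-- Each off-diagonal term is absorbed by 2|x_i x_j| ≤ x_i² + x_j²; symmetry then regroups the
squares by rows. -/
theorem dotProduct_mulVec_nonneg_of_diagDominant {ι : Type*} [Fintype ι] [DecidableEq ι]
    {M : Matrix ι ι ℝ} (hM : ∀ i j, M i j = M j i)
    (hd : ∀ i, ∑ j, (if i = j then 0 else |M i j|) ≤ M i i) (x : ι → ℝ) :
    0 ≤ x ⬝ᵥ M *ᵥ x := by
  set R : ι → ι → ℝ := fun i j => if i = j then 0 else |M i j|
  have hR : ∀ i j, R i j = R j i := fun i j => by simp only [R, hM i j, eq_comm]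
  have h1 : ∑ i, ∑ j, ((if i = j then M i i * x i ^ 2 else 0) -
      (R i j * x i ^ 2 / 2 + R j i * x j ^ 2 / 2)) ≤ x ⬝ᵥ M *ᵥ x := by
    simp only [dotProduct, mulVec, Finset.mul_sum]
    refine Finset.sum_le_sum fun i _ => Finset.sum_le_sum fun j _ => ?_
    rw [hR j i]
    by_cases h : i = j
    · subst h
      simp only [R, if_true]
      apply le_of_eq
      ring
    · simp only [R, if_neg h]
      have h3 : -(|M i j| * (|x i| * |x j|)) ≤ x i * (M i j * x j) := by
        rw [← abs_mul, ← abs_mul, show x i * (M i j * x j) = M i j * (x i * x j) by ring]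
        exact neg_abs_le _
      rw [← sq_abs (x i), ← sq_abs (x j)]
      nlinarith [mul_nonneg (abs_nonneg (M i j)) (sq_nonneg (|x i| - |x j|))]
  refine le_trans ?_ h1
  simp only [Finset.sum_sub_distrib, Finset.sum_add_distrib]
  rw [Finset.sum_comm (f := fun i j => R j i * x j ^ 2 / 2), ← Finset.sum_add_distrib,
    ← Finset.sum_sub_distrib]
  refine Finset.sum_nonneg fun i _ => ?_
  rw [← Finset.sum_add_distrib, Finset.sum_ite_eq, if_pos (Finset.mem_univ _)]
  simp_rw [add_halves]
  rw [← Finset.sum_mul, ← sub_mul]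
  exact mul_nonneg (sub_nonneg.2 (hd i)) (sq_nonneg _)

/-- The negated off-diagonal entries of the symmetric part of `L_m^{(α)}`, by distance to the
diagonal minus one. -/
noncomputable def offDiagCoeff (α : ℝ) : ℕ → ℝ
  | 0 => (wsgCoeff α 0 + wsgCoeff α 2) / 2
  | k + 1 => wsgCoeff α (k + 3) / 2

theorem offDiagCoeff_antitone {α : ℝ} (h1 : 1 < α) (h2 : α < 2) : Antitone (offDiagCoeff α) := by
  refine antitone_nat_of_succ_le fun k => ?_
  cases k with
  | zero =>
    simp only [offDiagCoeff]
    linarith [wsgCoeff_three_le h1]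
  | succ k =>
    simp only [offDiagCoeff]
    linarith [wsgCoeff_succ_le h1 h2 k]

theorem offDiagCoeff_nonneg {α : ℝ} (h1 : 1 < α) (h2 : α < 2) (k : ℕ) : 0 ≤ offDiagCoeff α k := by
  refine le_trans ?_ (offDiagCoeff_antitone h1 h2 (Nat.le_succ k))
  have := wsgCoeff_nonneg h1 h2 k
  simp only [offDiagCoeff]
  positivity

theorem two_mul_sum_offDiagCoeff_le {α : ℝ} (h1 : 1 < α) (h2 : α < 2) (N : ℕ) :
    2 * ∑ k ∈ Finset.range N, offDiagCoeff α k ≤ -wsgCoeff α 1 := by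
  have h := sum_wsgCoeff_nonpos h1 h2 N
  rw [Finset.sum_range_succ', Finset.sum_range_succ', Finset.sum_range_succ'] at h
  -- With one more term, b_0, …, b_N use exactly w_0, w_2, …, w_{N+2}, the terms of `h` apart from
  -- w_1.
  have h3 : 2 * ∑ k ∈ Finset.range N, offDiagCoeff α k ≤
      2 * ∑ k ∈ Finset.range (N + 1), offDiagCoeff α k := by
    rw [Finset.sum_range_succ]
    linarith [offDiagCoeff_nonneg h1 h2 N]
  refine h3.trans ?_
  rw [Finset.sum_range_succ', mul_add, Finset.mul_sum]
  simp only [offDiagCoeff, mul_div_cancel₀ _ (two_ne_zero' ℝ)]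
  simp only [zero_add, Nat.reduceAdd, add_assoc] at h ⊢
  linarith

theorem symPart_grunwaldMatrix_apply (α : ℝ) {m : ℕ} (i j : Fin m) :
    symPart (grunwaldMatrix α m) i j =
      if i = j then -wsgCoeff α 1
      else -offDiagCoeff α (((i : ℕ) - j) + ((j : ℕ) - i) - 1) := by
  simp only [symPart, grunwaldMatrix, Matrix.smul_apply, Matrix.add_apply, of_apply, transpose_apply, smul_eq_mul]
  rcases lt_trichotomy (i : ℕ) j with h | h | h
  · obtain ⟨l, hl⟩ : ∃ l, (j : ℕ) = i + 1 + l := ⟨j - i - 1, by omega⟩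
    rw [if_neg (show i ≠ j by rintro rfl; omega), hl, show (i : ℕ) - (i + 1 + l) + (i + 1 + l - i) - 1 = l by omega,
      show (i + 1 + l + 1 - i : ℕ) = l + 2 by omega,
      if_pos (show (i : ℕ) ≤ i + 1 + l + 1 by omega)]
    cases l with
    | zero =>
      simp [offDiagCoeff]
      ring
    | succ l =>
      rw [if_neg (by omega), offDiagCoeff]
      ring
  · obtain rfl := Fin.ext h
    simp
    ring
  · obtain ⟨l, hl⟩ : ∃ l, (i : ℕ) = j + 1 + l := ⟨i - j - 1, by omega⟩
    rw [if_neg (show i ≠ j by rintro rfl; omega), hl, show (j + 1 + l - j : ℕ) + (j - (j + 1 + l)) - 1 = l by omega,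
      show (j + 1 + l + 1 - j : ℕ) = l + 2 by omega, if_pos (by omega)]
    cases l with
    | zero =>
      simp [offDiagCoeff]
      ring
    | succ l =>
      rw [if_neg (by omega), offDiagCoeff]
      ring

theorem firstColumn_symPart_grunwaldMatrix (α : ℝ) {m k : ℕ} (hk : k < m) (hk0 : 0 < k) :
    firstColumn (symPart (grunwaldMatrix α m)) k = -offDiagCoeff α (k - 1) := by
  rw [firstColumn, dif_pos hk, symPart_grunwaldMatrix_apply, if_neg]
  · simp
  · intro h
    exact hk0.ne' (congrArg Fin.val h)

theorem hankelCorrection_apply (α : ℝ) {m : ℕ} (i j : Fin m) :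
    hankelCorrection (symPart (grunwaldMatrix α m)) i j =
      -((if (i : ℕ) + j + 2 < m then offDiagCoeff α (i + j + 1) else 0) +
        if m + 1 ≤ (i : ℕ) + j then offDiagCoeff α (2 * m - (i + j) - 1) else 0) := by
  rw [hankelCorrection, of_apply]
  split_ifs with h h' h'
  · omega
  · rw [firstColumn_symPart_grunwaldMatrix α h (by omega)]
    simp
  · rw [firstColumn_symPart_grunwaldMatrix α (by omega) (by omega)]
    simp
  · simp

/-- Used on a half-row: the values picked by f and g are pairwise distinct indices below m, so no b
k is counted twice. -/
theorem sum_ite_add_ite_le {b : ℕ → ℝ} (hb : ∀ k, 0 ≤ b k) {m : ℕ} (p q : ℕ → Prop)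
    [DecidablePred p] [DecidablePred q] (f g : ℕ → ℕ)
    (hf : ∀ j < m, p j → f j < m) (hg : ∀ j < m, q j → g j < m)
    (hf' : ∀ j < m, ∀ k < m, p j → p k → f j = f k → j = k)
    (hg' : ∀ j < m, ∀ k < m, q j → q k → g j = g k → j = k)
    (hfg : ∀ j < m, ∀ k < m, p j → q k → f j ≠ g k) :
    ∑ j ∈ Finset.range m, ((if p j then b (f j) else 0) + if q j then b (g j) else 0) ≤
      ∑ k ∈ Finset.range m, b k := by
  rw [Finset.sum_add_distrib, ← Finset.sum_filter, ← Finset.sum_filter,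
    ← Finset.sum_image (f := b) (g := f), ← Finset.sum_image (f := b) (g := g),
    ← Finset.sum_union]
  · refine Finset.sum_le_sum_of_subset_of_nonneg ?_ fun k _ _ => hb k
    intro k
    simp only [Finset.mem_union, Finset.mem_image, Finset.mem_filter, Finset.mem_range]
    rintro (⟨j, ⟨hj, hp⟩, rfl⟩ | ⟨j, ⟨hj, hp⟩, rfl⟩)
    exacts [hf j hj hp, hg j hj hp]
  · rw [Finset.disjoint_left]
    simp only [Finset.mem_image, Finset.mem_filter, Finset.mem_range]
    rintro _ ⟨j, ⟨hj, hp⟩, rfl⟩ ⟨k, ⟨hk, hq⟩, h⟩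
    exact hfg j hj k hk hp hq h.symm
  · intro j hj k hk h
    simp only [Finset.coe_filter, Finset.mem_range, Set.mem_ofPred_eq] at hj hk
    exact hg' j hj.1 k hk.1 hj.2 hk.2 h
  · intro j hj k hk h
    simp only [Finset.coe_filter, Finset.mem_range, Set.mem_ofPred_eq] at hj hk
    exact hf' j hj.1 k hk.1 hj.2 hk.2 h

theorem abs_hankelCorrection {α : ℝ} (h1 : 1 < α) (h2 : α < 2) {m : ℕ} (i j : Fin m) :
    |hankelCorrection (symPart (grunwaldMatrix α m)) i j| =
      (if (i : ℕ) + j + 2 < m then offDiagCoeff α (i + j + 1) else 0) +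
        if m + 1 ≤ (i : ℕ) + j then offDiagCoeff α (2 * m - (i + j) - 1) else 0 := by
  rw [hankelCorrection_apply, abs_neg, abs_of_nonneg]
  have := offDiagCoeff_nonneg h1 h2
  refine add_nonneg ?_ ?_ <;> split_ifs <;> first | exact this _ | exact le_rfl

theorem hankelCorrection_nonpos {α : ℝ} (h1 : 1 < α) (h2 : α < 2) {m : ℕ} (i j : Fin m) :
    hankelCorrection (symPart (grunwaldMatrix α m)) i j ≤ 0 := by
  rw [hankelCorrection_apply, ← abs_hankelCorrection h1 h2]
  simp

/-- The single row estimate behind both dominance statements. The entries of T left of the diagonal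
together with the upper-left part of H use each coefficient b_k at most once, and so do the entries
right of the diagonal with the lower-right part of H. Twice the sum of the b_k is at most the
diagonal entry -w_1. -/
theorem sum_abs_symPart_add_abs_hankelCorrection_le {α : ℝ} (h1 : 1 < α) (h2 : α < 2) {m : ℕ}
    (i : Fin m) :
    ∑ j, ((if i = j then 0 else |symPart (grunwaldMatrix α m) i j|) +
      |hankelCorrection (symPart (grunwaldMatrix α m)) i j|) ≤
        symPart (grunwaldMatrix α m) i i := by
  have hb := offDiagCoeff_nonneg h1 h2
  have hi := i.2
  rw [symPart_grunwaldMatrix_apply, if_pos rfl]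
  refine le_trans (le_of_eq ?_) (two_mul_sum_offDiagCoeff_le h1 h2 m |>.trans' <|
    (add_le_add
      -- Left half: T uses the indices 0, …, i-1 and H uses i+1, …, m-2. Right half: T uses 0, …,
      -- m-i-2 and H uses m-i, …, m-2.
      (sum_ite_add_ite_le hb (m := m) (fun j => j < i) (fun j => (i : ℕ) + j + 2 < m)
        (fun j => (i : ℕ) - j - 1) (fun j => i + j + 1)
        (by omega) (by omega) (by omega) (by omega) (by omega))
      (sum_ite_add_ite_le hb (m := m) (fun j => (i : ℕ) < j) (fun j => m + 1 ≤ (i : ℕ) + j)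
        (fun j => j - i - 1) (fun j => 2 * m - (i + j) - 1)
        (by omega) (by omega) (by omega) (by omega) (by omega))).trans_eq (two_mul _).symm)
  rw [← Finset.sum_add_distrib, Finset.sum_range]
  refine Finset.sum_congr rfl fun j _ => ?_
  rw [abs_hankelCorrection h1 h2, symPart_grunwaldMatrix_apply]
  rcases lt_trichotomy (i : ℕ) j with h | h | h
  · have hne : i ≠ j := by rintro rfl; omega
    rw [if_neg hne, if_neg hne, abs_neg, abs_of_nonneg (hb _), if_neg (show ¬(j : ℕ) < i by omega), if_pos h,
      show (i : ℕ) - j + (j - i) - 1 = j - i - 1 by omega]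
    ring
  · obtain rfl := Fin.ext h
    simp
  · have hne : i ≠ j := by rintro rfl; omega
    rw [if_neg hne, if_neg hne, abs_neg, abs_of_nonneg (hb _), if_pos h, if_neg (show ¬(i : ℕ) < j by omega),
      show (i : ℕ) - j + (j - i) - 1 = i - j - 1 by omega]
    ring

/-- The coefficients decrease, and |i-j| - 1 is at most both Hankel indices i+j+1 and 2m-(i+j)-1. -/
theorem symPart_le_hankelCorrection {α : ℝ} (h1 : 1 < α) (h2 : α < 2) {m : ℕ} {i j : Fin m}
    (hij : i ≠ j) : symPart (grunwaldMatrix α m) i j ≤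
      hankelCorrection (symPart (grunwaldMatrix α m)) i j := by
  have hb := offDiagCoeff_nonneg h1 h2
  have ha := offDiagCoeff_antitone h1 h2
  rw [hankelCorrection_apply, symPart_grunwaldMatrix_apply, if_neg hij, neg_le_neg_iff]
  split_ifs with h h' h'
  · omega
  · rw [add_zero]
    exact ha (by omega)
  · rw [zero_add]
    exact ha (by omega)
  · simpa using hb _

theorem symPart_apply_comm {ι : Type*} (Z : Matrix ι ι ℝ) (i j : ι) :
    symPart Z i j = symPart Z j i := by
  simp [symPart, add_comm]

theorem hankelCorrection_apply_comm {m : ℕ} (T : Matrix (Fin m) (Fin m) ℝ) (i j : Fin m) :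
    hankelCorrection T i j = hankelCorrection T j i := by
  simp [hankelCorrection, add_comm (i : ℕ)]

theorem tauMatrix_symPart_apply_comm {m : ℕ} (Z : Matrix (Fin m) (Fin m) ℝ) (i j : Fin m) :
    tauMatrix (symPart Z) i j = tauMatrix (symPart Z) j i := by
  simp only [tauMatrix, Matrix.sub_apply]
  rw [symPart_apply_comm, hankelCorrection_apply_comm]

/-- Since 2T - τ(T) = T + H, this is diagonal dominance of T + H. -/
theorem tauMatrix_le_two_mul {α : ℝ} (h1 : 1 < α) (h2 : α < 2) {m : ℕ} (x : Fin m → ℝ) :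
    x ⬝ᵥ tauMatrix (symPart (grunwaldMatrix α m)) *ᵥ x ≤
      2 * (x ⬝ᵥ symPart (grunwaldMatrix α m) *ᵥ x) := by
  set T := symPart (grunwaldMatrix α m)
  have hT : ∀ i j, T i j = T j i := symPart_apply_comm _
  have h := dotProduct_mulVec_nonneg_of_diagDominant (M := T + hankelCorrection T)
    (fun i j => by rw [Matrix.add_apply, Matrix.add_apply, hT, hankelCorrection_apply_comm])
    (fun i => by
      have hs := sum_abs_symPart_add_abs_hankelCorrection_le h1 h2 i
      rw [← Finset.add_sum_erase _ _ (Finset.mem_univ i), if_pos rfl] at hs ⊢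
      have hle : ∑ j ∈ Finset.univ.erase i, (if i = j then 0 else |(T + hankelCorrection T) i j|) ≤
          ∑ j ∈ Finset.univ.erase i, ((if i = j then 0 else |T i j|) +
            |hankelCorrection T i j|) := by
        refine Finset.sum_le_sum fun j hj => ?_
        have hij := (Finset.ne_of_mem_erase hj).symm
        rw [if_neg hij, if_neg hij]
        exact abs_add_le _ _
      have := neg_abs_le (hankelCorrection T i i)
      rw [Matrix.add_apply]
      linarith) x
  rw [add_mulVec, dotProduct_add] at h
  rw [tauMatrix, sub_mulVec, dotProduct_sub]
  linarith

/-- Since 3τ(T) - 2T = T - 3H, this is diagonal dominance of T - 3H. Off the diagonal T ≤ H ≤ 0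
gives |T - 3H| ≤ |T| + |H|, and 3 is the largest factor for which these signs suffice. On the
diagonal -3H only helps. -/
theorem two_mul_le_three_mul_tauMatrix {α : ℝ} (h1 : 1 < α) (h2 : α < 2) {m : ℕ}
    (x : Fin m → ℝ) :
    2 * (x ⬝ᵥ symPart (grunwaldMatrix α m) *ᵥ x) ≤
      3 * (x ⬝ᵥ tauMatrix (symPart (grunwaldMatrix α m)) *ᵥ x) := by
  set T := symPart (grunwaldMatrix α m)
  have hT : ∀ i j, T i j = T j i := symPart_apply_comm _
  have h := dotProduct_mulVec_nonneg_of_diagDominant (M := T - (3 : ℝ) • hankelCorrection T)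
    (fun i j => by
      simp only [Matrix.sub_apply, Matrix.smul_apply]
      rw [hT, hankelCorrection_apply_comm])
    (fun i => by
      have hs := sum_abs_symPart_add_abs_hankelCorrection_le h1 h2 i
      rw [← Finset.add_sum_erase _ _ (Finset.mem_univ i), if_pos rfl] at hs ⊢
      have hle : ∑ j ∈ Finset.univ.erase i,
          (if i = j then 0 else |(T - (3 : ℝ) • hankelCorrection T) i j|) ≤
          ∑ j ∈ Finset.univ.erase i, ((if i = j then 0 else |T i j|) +
            |hankelCorrection T i j|) := by
        refine Finset.sum_le_sum fun j hj => ?_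
        have hij := (Finset.ne_of_mem_erase hj).symm
        have k1 : T i j ≤ hankelCorrection T i j := symPart_le_hankelCorrection h1 h2 hij
        have k2 : hankelCorrection T i j ≤ 0 := hankelCorrection_nonpos h1 h2 i j
        rw [if_neg hij, if_neg hij, abs_of_nonpos k2, abs_of_nonpos (k1.trans k2), Matrix.sub_apply,
          Matrix.smul_apply, smul_eq_mul, abs_le]
        constructor <;> linarith
      have k2 : hankelCorrection T i i ≤ 0 := hankelCorrection_nonpos h1 h2 i i
      rw [abs_of_nonpos k2] at hs
      rw [Matrix.sub_apply, Matrix.smul_apply, smul_eq_mul]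
      linarith) x
  rw [sub_mulVec, smul_mulVec, dotProduct_sub, dotProduct_smul, smul_eq_mul] at h
  rw [tauMatrix, sub_mulVec, dotProduct_sub]
  linarith

/-! ### Symmetry under index reversal -/

theorem grunwaldMatrix_rev (α : ℝ) {m : ℕ} (i j : Fin m) :
    grunwaldMatrix α m i.rev j.rev = grunwaldMatrix α m j i := by
  simp only [grunwaldMatrix, of_apply, Fin.val_rev]
  by_cases h : (i : ℕ) ≤ j + 1
  · rw [if_pos h, if_pos (by omega)]
    congr 2
    omega
  · rw [if_neg h, if_neg (by omega)]

theorem tauMatrix_rev (α : ℝ) {m : ℕ} (i j : Fin m) :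
    tauMatrix (symPart (grunwaldMatrix α m)) i.rev j.rev =
      tauMatrix (symPart (grunwaldMatrix α m)) i j := by
  have hT : symPart (grunwaldMatrix α m) i.rev j.rev = symPart (grunwaldMatrix α m) i j := by
    simp only [symPart, Matrix.smul_apply, Matrix.add_apply, transpose_apply, grunwaldMatrix_rev]
    rw [add_comm]
  simp only [tauMatrix, Matrix.sub_apply, hT]
  congr 1
  simp only [hankelCorrection, of_apply, Fin.val_rev]
  split_ifs <;> first | rfl | omega | (congr 1; omega)

/-! ### Sectorial matrices and symmetric-definite pencils -/

theorem dotProduct_transpose_mulVec_comm {ι : Type*} [Fintype ι] (M : Matrix ι ι ℝ) (x y : ι → ℝ) :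
    x ⬝ᵥ Mᵀ *ᵥ y = y ⬝ᵥ M *ᵥ x := by
  rw [mulVec_transpose, dotProduct_comm, dotProduct_mulVec]

theorem dotProduct_symPart_mulVec {ι : Type*} [Fintype ι] (Z : Matrix ι ι ℝ) (x y : ι → ℝ) :
    x ⬝ᵥ symPart Z *ᵥ y = (x ⬝ᵥ Z *ᵥ y + y ⬝ᵥ Z *ᵥ x) / 2 := by
  rw [symPart, smul_mulVec, add_mulVec, dotProduct_smul, dotProduct_add,
    dotProduct_transpose_mulVec_comm, smul_eq_mul]
  ring

theorem isUnit_of_dotProduct_mulVec_pos {ι : Type*} [Fintype ι] [DecidableEq ι] {M : Matrix ι ι ℝ}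
    (h : ∀ x : ι → ℝ, x ≠ 0 → 0 < x ⬝ᵥ M *ᵥ x) : IsUnit M := by
  rw [← mulVec_injective_iff_isUnit]
  intro x y hxy
  by_contra hne
  have := h (x - y) (sub_ne_zero.2 hne)
  rw [mulVec_sub, sub_eq_zero.2 hxy, dotProduct_zero] at this
  exact this.false

theorem sq_dotProduct_mulVec_le {ι : Type*} [Fintype ι] {M : Matrix ι ι ℝ} (hM : Mᵀ = M)
    (h : ∀ x : ι → ℝ, x ≠ 0 → 0 < x ⬝ᵥ M *ᵥ x) (x y : ι → ℝ) :
    (x ⬝ᵥ M *ᵥ y) ^ 2 ≤ (x ⬝ᵥ M *ᵥ x) * (y ⬝ᵥ M *ᵥ y) := by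
  rcases eq_or_ne x 0 with rfl | hx
  · simp
  have hp := h x hx
  have h0 : 0 ≤ (y - ((x ⬝ᵥ M *ᵥ y) / (x ⬝ᵥ M *ᵥ x)) • x) ⬝ᵥ M *ᵥ
      (y - ((x ⬝ᵥ M *ᵥ y) / (x ⬝ᵥ M *ᵥ x)) • x) := by
    rcases eq_or_ne (y - ((x ⬝ᵥ M *ᵥ y) / (x ⬝ᵥ M *ᵥ x)) • x) 0 with h0 | h0
    · simp [h0]
    · exact (h _ h0).le
  have hs : y ⬝ᵥ M *ᵥ x = x ⬝ᵥ M *ᵥ y := by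
    rw [← dotProduct_transpose_mulVec_comm, hM]
  simp only [mulVec_sub, mulVec_smul, sub_dotProduct, dotProduct_sub, smul_dotProduct,
    dotProduct_smul, smul_eq_mul, hs] at h0
  generalize x ⬝ᵥ M *ᵥ y = b at *
  generalize x ⬝ᵥ M *ᵥ x = a at *
  generalize y ⬝ᵥ M *ᵥ y = c at *
  have : c - b / a * b - b / a * (b - b / a * a) = (a * c - b ^ 2) / a := by
    field_simp
    ring
  rw [this, div_nonneg_iff] at h0
  rcases h0 with h0 | h0 <;> linarith [h0.1, h0.2]

/-- If the skew part of `A` is bounded by `μ` times its positive definite symmetric part `H`, then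
`A` has norm at most `√(1 + μ²)` relative to the inner product of `H`. -/
theorem sq_dotProduct_mulVec_le_of_sector {ι : Type*} [Fintype ι] [DecidableEq ι]
    {A : Matrix ι ι ℝ} {μ : ℝ} (hμ : 0 ≤ μ) (hA : ∀ x : ι → ℝ, x ≠ 0 → 0 < x ⬝ᵥ A *ᵥ x)
    (hs : ∀ x y : ι → ℝ, |x ⬝ᵥ A *ᵥ y - y ⬝ᵥ A *ᵥ x| ≤ μ * (x ⬝ᵥ A *ᵥ x + y ⬝ᵥ A *ᵥ y))
    (x y : ι → ℝ) :
    (y ⬝ᵥ A *ᵥ x) ^ 2 ≤ (1 + μ ^ 2) * (x ⬝ᵥ A *ᵥ x) * (y ⬝ᵥ A *ᵥ y) := by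
  have hq : ∀ x : ι → ℝ, x ⬝ᵥ symPart A *ᵥ x = x ⬝ᵥ A *ᵥ x := fun x => by
    rw [dotProduct_symPart_mulVec]; ring
  have hH : ∀ x : ι → ℝ, x ≠ 0 → 0 < x ⬝ᵥ symPart A *ᵥ x := fun x hx => by
    rw [hq]; exact hA x hx
  have hHs : (symPart A)ᵀ = symPart A := by
    ext i j
    exact symPart_apply_comm A j i
  -- With S the symmetric part and K the skew part, g = S⁻¹Kx, so that Ax = S(x + g). As xᵀKx = 0,
  -- the vectors x and g are S-orthogonal.
  obtain ⟨g, hg⟩ := mulVec_surjective_iff_isUnit.2 (isUnit_of_dotProduct_mulVec_pos hH)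
    (A *ᵥ x - symPart A *ᵥ x)
  have hxg : symPart A *ᵥ (x + g) = A *ᵥ x := by
    rw [mulVec_add, hg, add_sub_cancel]
  have hcs := sq_dotProduct_mulVec_le hHs hH y (x + g)
  have hgx : x ⬝ᵥ symPart A *ᵥ g = 0 := by
    rw [hg, dotProduct_sub, hq, sub_self]
  have hxg' : g ⬝ᵥ symPart A *ᵥ x = 0 := by
    rw [← dotProduct_transpose_mulVec_comm, hHs, hgx]
  have hgg : g ⬝ᵥ A *ᵥ g = (g ⬝ᵥ A *ᵥ x - x ⬝ᵥ A *ᵥ g) / 2 := by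
    rw [← hq, hg, dotProduct_sub, dotProduct_symPart_mulVec]
    ring
  have hexp : (x + g) ⬝ᵥ symPart A *ᵥ (x + g) = x ⬝ᵥ A *ᵥ x + g ⬝ᵥ A *ᵥ g := by
    rw [mulVec_add, dotProduct_add, add_dotProduct, add_dotProduct, hgx, hxg', hq, hq]
    ring
  have hbound : g ⬝ᵥ A *ᵥ g ≤ μ ^ 2 * (x ⬝ᵥ A *ᵥ x) := by
    rcases hμ.eq_or_lt with rfl | hμ
    · have := (le_abs_self _).trans (hs g x)
      rw [hgg]
      linarith
    -- Scaling x by μ balances the two terms: 2μ gᵀAg ≤ μ(gᵀAg + μ² xᵀAx).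
    · have := (le_abs_self _).trans (hs g (μ • x))
      simp only [mulVec_smul, dotProduct_smul, smul_dotProduct, smul_eq_mul] at this
      have h3 : g ⬝ᵥ A *ᵥ x - x ⬝ᵥ A *ᵥ g = 2 * (g ⬝ᵥ A *ᵥ g) := by linarith
      rw [← mul_sub, h3] at this
      have := le_of_mul_le_mul_left this hμ
      nlinarith
  have hy : 0 ≤ y ⬝ᵥ A *ᵥ y := by
    rcases eq_or_ne y 0 with rfl | h
    · simp
    · exact (hA y h).le
  rw [hexp, hxg, hq] at hcs
  refine hcs.trans ?_
  rw [mul_comm]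
  exact mul_le_mul_of_nonneg_right (by linarith) hy

theorem re_map_ofReal_mulVec {ι : Type*} [Fintype ι] (M : Matrix ι ι ℝ) (w : ι → ℂ) (i : ι) :
    ((M.map Complex.ofReal *ᵥ w) i).re = (M *ᵥ fun j => (w j).re) i := by
  simp [mulVec, dotProduct]

theorem im_map_ofReal_mulVec {ι : Type*} [Fintype ι] (M : Matrix ι ι ℝ) (w : ι → ℂ) (i : ι) :
    ((M.map Complex.ofReal *ᵥ w) i).im = (M *ᵥ fun j => (w j).im) i := by
  simp [mulVec, dotProduct]

/-- The eigenvalues of a symmetric-definite pencil are real and have real eigenvectors. -/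
theorem exists_real_eigenvector {ι : Type*} [Fintype ι] [DecidableEq ι] {B P : Matrix ι ι ℝ}
    (hB : Bᵀ = B) (hPs : Pᵀ = P) (hP : ∀ x : ι → ℝ, x ≠ 0 → 0 < x ⬝ᵥ P *ᵥ x) {z : ℂ}
    (hz : Module.End.HasEigenvalue (Matrix.toLin' ((P⁻¹ * B).map Complex.ofReal)) z) :
    ∃ (a : ℝ) (x : ι → ℝ), (a : ℂ) = z ∧ x ≠ 0 ∧ B *ᵥ x = a • P *ᵥ x := by
  obtain ⟨w, hw⟩ := hz.exists_hasEigenvector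
  have hw0 := hw.2
  have hw1 := hw.apply_eq_smul
  rw [toLin'_apply] at hw1
  have hdet : IsUnit P.det := (isUnit_iff_isUnit_det _).1 (isUnit_of_dotProduct_mulVec_pos hP)
  set u : ι → ℝ := fun j => (w j).re
  set v : ι → ℝ := fun j => (w j).im
  have hu : (P⁻¹ * B) *ᵥ u = z.re • u - z.im • v := by
    ext i
    rw [← re_map_ofReal_mulVec, hw1]
    simp [u, v]
  have hv : (P⁻¹ * B) *ᵥ v = z.re • v + z.im • u := by
    ext i
    rw [← im_map_ofReal_mulVec, hw1]
    simp [u, v]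
  have hPB : ∀ x, P *ᵥ ((P⁻¹ * B) *ᵥ x) = B *ᵥ x := fun x => by
    rw [mulVec_mulVec, ← Matrix.mul_assoc, mul_nonsing_inv _ hdet, Matrix.one_mul]
  have hBu := hPB u
  have hBv := hPB v
  rw [hu, mulVec_sub, mulVec_smul, mulVec_smul] at hBu
  rw [hv, mulVec_add, mulVec_smul, mulVec_smul] at hBv
  have hnn : ∀ x, 0 ≤ x ⬝ᵥ P *ᵥ x := fun x => by
    rcases eq_or_ne x 0 with rfl | h
    · simp
    · exact (hP x h).le
  have huv : u ≠ 0 ∨ v ≠ 0 := by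
    by_contra! h
    apply hw0
    ext i
    exact Complex.ext (congrFun h.1 i) (congrFun h.2 i)
  have hpos : 0 < u ⬝ᵥ P *ᵥ u + v ⬝ᵥ P *ᵥ v := by
    rcases huv with h | h
    · exact add_pos_of_pos_of_nonneg (hP _ h) (hnn _)
    · exact add_pos_of_nonneg_of_pos (hnn _) (hP _ h)
  have him : z.im = 0 := by
    -- Symmetry of B and P leaves only Im z · (uᵀPu + vᵀPv) = 0.
    have e1 : u ⬝ᵥ B *ᵥ v = v ⬝ᵥ B *ᵥ u := by
      rw [← dotProduct_transpose_mulVec_comm, hB]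
    have e2 : u ⬝ᵥ P *ᵥ v = v ⬝ᵥ P *ᵥ u := by
      rw [← dotProduct_transpose_mulVec_comm, hPs]
    rw [← hBu, ← hBv, dotProduct_add, dotProduct_sub] at e1
    simp only [dotProduct_smul, smul_eq_mul, e2] at e1
    have : z.im * (u ⬝ᵥ P *ᵥ u + v ⬝ᵥ P *ᵥ v) = 0 := by linarith
    exact (mul_eq_zero.1 this).resolve_right hpos.ne'
  rw [him, zero_smul] at hBu hBv
  rw [sub_zero] at hBu
  rw [add_zero] at hBv
  have hre : (z.re : ℂ) = z := Complex.ext rfl (by simp [him])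
  rcases huv with h | h
  exacts [⟨z.re, u, hre, h, hBu.symm⟩, ⟨z.re, v, hre, h, hBv.symm⟩]

theorem mulVec_comp_equiv {ι : Type*} [Fintype ι] {M N : Matrix ι ι ℝ} (σ : Equiv.Perm ι)
    (h : ∀ p q, M (σ p) (σ q) = N p q) (x : ι → ℝ) : N *ᵥ (x ∘ σ) = (M *ᵥ x) ∘ σ := by
  ext p
  simp only [mulVec, dotProduct, Function.comp_apply, ← h]
  exact Equiv.sum_comp σ fun q => M (σ p) q * x q

theorem mem_spectralSet_iff {x ε : ℝ} :
    x ∈ spectralSet ε ↔ 1 / 2 < |x| ∧ |x| < 3 / 2 * (1 + ε) := by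
  simp only [spectralSet, Set.mem_union, Set.mem_Ioo]
  rcases le_total 0 x with h | h
  · rw [abs_of_nonneg h]
    constructor
    · rintro (h' | h')
      · linarith
      · exact h'
    · exact Or.inr
  · rw [abs_of_nonpos h]
    constructor
    · rintro (h' | h') <;> constructor <;> linarith
    · rintro ⟨_, _⟩
      left
      constructor <;> linarith

theorem eigenvaluesIn_spectralSet {ι : Type*} [Fintype ι] [DecidableEq ι] {A P Y : Matrix ι ι ℝ}
    {μ : ℝ} (hμ : 0 ≤ μ) (σ : Equiv.Perm ι) (hσ : ∀ p, σ (σ p) = p)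
    (hY : ∀ x, Y *ᵥ x = x ∘ σ) (hAσ : ∀ p q, A (σ p) (σ q) = A q p)
    (hPσ : ∀ p q, P (σ p) (σ q) = P p q) (hPs : Pᵀ = P)
    (hP : ∀ x : ι → ℝ, x ≠ 0 → 0 < x ⬝ᵥ P *ᵥ x)
    (hPA : ∀ x : ι → ℝ, x ≠ 0 → x ⬝ᵥ P *ᵥ x < 2 * (x ⬝ᵥ A *ᵥ x))
    (hAP : ∀ x : ι → ℝ, x ≠ 0 → 2 * (x ⬝ᵥ A *ᵥ x) < 3 * (x ⬝ᵥ P *ᵥ x))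
    (hs : ∀ x y : ι → ℝ, |x ⬝ᵥ A *ᵥ y - y ⬝ᵥ A *ᵥ x| ≤ μ * (x ⬝ᵥ A *ᵥ x + y ⬝ᵥ A *ᵥ y)) :
    EigenvaluesIn (P⁻¹ * (Y * A)) (spectralSet (Real.sqrt (1 + μ ^ 2) - 1)) := by
  intro z hz
  have hσσ : ∀ x : ι → ℝ, (x ∘ σ) ∘ σ = x := fun x => by
    ext p
    simp [hσ]
  have hdot : ∀ x y : ι → ℝ, (x ∘ σ) ⬝ᵥ (y ∘ σ) = x ⬝ᵥ y := fun x y =>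
    Equiv.sum_comp σ fun p => x p * y p
  have hA : ∀ x : ι → ℝ, x ≠ 0 → 0 < x ⬝ᵥ A *ᵥ x := fun x hx => by
    linarith [hPA x hx, hP x hx]
  -- Y is a symmetric permutation matrix and conjugation by it transposes A, so (YA)ᵀ = AᵀY = YA.
  have hYA : (Y * A)ᵀ = Y * A := by
    refine ext_of_mulVec_single fun q => ?_
    ext p
    have hAt : (Aᵀ) *ᵥ ((Pi.single q 1 : ι → ℝ) ∘ σ) = (A *ᵥ Pi.single q 1) ∘ σ :=
      mulVec_comp_equiv σ hAσ _
    have hYt : Yᵀ = Y := by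
      have hYe : ∀ i j, Y i j = if σ i = j then 1 else 0 := fun i j => by
        have := congrFun (hY (Pi.single j 1)) i
        rw [mulVec_single_one, Matrix.col_apply, Function.comp_apply, Pi.single_apply] at this
        exact this
      ext i j
      rw [transpose_apply, hYe, hYe]
      congr 1
      rw [eq_iff_iff]
      constructor <;> rintro rfl <;> simp [hσ]
    rw [transpose_mul, hYt, ← mulVec_mulVec, ← mulVec_mulVec, hY, hY, hAt]
  obtain ⟨a, x, ha, hx, hax⟩ := exists_real_eigenvector hYA hPs hP hz
  refine ⟨a, ?_, ha⟩
  rw [mem_spectralSet_iff]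
  set y := x ∘ σ with hy
  have hy0 : y ≠ 0 := fun h => hx (by rw [← hσσ x, ← hy, h]; rfl)
  have hPy : P *ᵥ y = (P *ᵥ x) ∘ σ := mulVec_comp_equiv σ hPσ x
  have hyPy : y ⬝ᵥ P *ᵥ y = x ⬝ᵥ P *ᵥ x := by rw [hPy, hy, hdot]
  have hAx : A *ᵥ x = a • P *ᵥ y := by
    rw [← mulVec_mulVec, hY] at hax
    rw [hPy, ← hσσ (A *ᵥ x), hax]
    rfl
  have hpx := hP x hx
  have hsq : (x ⬝ᵥ P *ᵥ y) ^ 2 ≤ (x ⬝ᵥ P *ᵥ x) ^ 2 := by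
    have := sq_dotProduct_mulVec_le hPs hP x y
    rwa [hyPy, ← sq] at this
  constructor
  -- Lower bound: test Ax = aPy with x.
  · have h1 : |x ⬝ᵥ P *ᵥ y| ≤ x ⬝ᵥ P *ᵥ x := abs_le_of_sq_le_sq hsq hpx.le
    have h2 : x ⬝ᵥ A *ᵥ x = a * (x ⬝ᵥ P *ᵥ y) := by rw [hAx, dotProduct_smul, smul_eq_mul]
    have h3 := hPA x hx
    have h4 : x ⬝ᵥ A *ᵥ x ≤ |a| * (x ⬝ᵥ P *ᵥ x) := by
      rw [h2]
      refine (le_abs_self _).trans ?_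
      rw [abs_mul]
      exact mul_le_mul_of_nonneg_left h1 (abs_nonneg a)
    by_contra! h
    nlinarith
  -- Upper bound: test Ax = aPy with y, which has the same P-norm as x.
  · have h1 := sq_dotProduct_mulVec_le_of_sector hμ hA hs x y
    have h2 : y ⬝ᵥ A *ᵥ x = a * (x ⬝ᵥ P *ᵥ x) := by
      rw [hAx, dotProduct_smul, smul_eq_mul, hyPy]
    have h3 := hAP x hx
    have h4 := hAP y hy0
    rw [hyPy] at h4
    have h5 := hA x hx
    have h6 := hA y hy0
    rw [h2] at h1
    have h7 : (x ⬝ᵥ A *ᵥ x) * (y ⬝ᵥ A *ᵥ y) < (3 / 2 * (x ⬝ᵥ P *ᵥ x)) ^ 2 := by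
      rw [sq]
      exact mul_lt_mul'' (by linarith) (by linarith) h5.le h6.le
    have h8 : (a * (x ⬝ᵥ P *ᵥ x)) ^ 2 < (1 + μ ^ 2) * (3 / 2 * (x ⬝ᵥ P *ᵥ x)) ^ 2 := by
      refine h1.trans_lt ?_
      rw [mul_assoc]
      exact mul_lt_mul_of_pos_left h7 (by positivity)
    have h9 : a ^ 2 < (3 / 2 * Real.sqrt (1 + μ ^ 2)) ^ 2 := by
      rw [mul_pow, Real.sq_sqrt (by positivity)]
      have h10 : 0 < (x ⬝ᵥ P *ᵥ x) ^ 2 := by positivity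
      refine lt_of_mul_lt_mul_right (a := (x ⬝ᵥ P *ᵥ x) ^ 2) ?_ h10.le
      linarith
    rw [add_sub_cancel]
    exact abs_lt_of_sq_lt_sq h9 (by positivity)

/-- There are finitely many eigenvalues and each satisfies the strict outer bound, so that bound can
be tightened a little. This gives ε < μ on a single mesh even when μ = 0, where ε must be negative.
-/
theorem EigenvaluesIn.exists_lt {ι : Type*} [Fintype ι] [DecidableEq ι] {X : Matrix ι ι ℝ} {ε : ℝ}
    (h : EigenvaluesIn X (spectralSet ε)) : ∃ ε' < ε, EigenvaluesIn X (spectralSet ε') := by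
  have hfin := Module.End.finite_hasEigenvalue (f := Matrix.toLin' (X.map Complex.ofReal))
  have hev : ∀ᶠ ε' in nhdsWithin ε (Set.Iio ε),
      ∀ z ∈ {z | Module.End.HasEigenvalue (Matrix.toLin' (X.map Complex.ofReal)) z},
        ∃ x ∈ spectralSet ε', (x : ℂ) = z := by
    rw [Filter.eventually_all_finite hfin]
    intro z hz
    obtain ⟨x, hx, hxz⟩ := h z hz
    rw [mem_spectralSet_iff] at hx
    have hc : Continuous fun ε' : ℝ => 3 / 2 * (1 + ε') := by fun_prop
    filter_upwards [nhdsWithin_le_nhds (hc.continuousAt.eventually (eventually_gt_nhds hx.2))]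
      with ε' hε'
    exact ⟨x, mem_spectralSet_iff.2 ⟨hx.1, hε'⟩, hxz⟩
  obtain ⟨ε', h1, h2⟩ := (hev.and self_mem_nhdsWithin).exists
  exact ⟨ε', h2, h1⟩

/-! ### From one dimension to the multilevel matrices -/

variable {d : ℕ} {n : Fin d → ℕ}

/-- The restriction of a grid function to the grid line in direction `i` through `r`. -/
def fiber (i : Fin d) (x : MultiIndex n → ℝ) (r : ∀ j : {j // j ≠ i}, Fin (n j)) : Fin (n i) → ℝ :=
  fun a => x ((Equiv.piSplitAt i fun j => Fin (n j)).symm (a, r))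

theorem inDirection_apply_piSplitAt_symm (i : Fin d) (M : Matrix (Fin (n i)) (Fin (n i)) ℝ)
    (a b : Fin (n i)) (r s : ∀ j : {j // j ≠ i}, Fin (n j)) :
    inDirection i M ((Equiv.piSplitAt i fun j => Fin (n j)).symm (a, r))
      ((Equiv.piSplitAt i fun j => Fin (n j)).symm (b, s)) = if r = s then M a b else 0 := by
  simp only [inDirection, kroneckerProd, of_apply]
  split_ifs with h
  · subst h
    rw [Finset.prod_eq_single i]
    · simp [Equiv.piSplitAt]
    · intro j _ hj
      simp [Equiv.piSplitAt, hj]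
    · simp
  · obtain ⟨j, hj⟩ := Function.ne_iff.1 h
    refine Finset.prod_eq_zero (Finset.mem_univ (j : Fin d)) ?_
    rw [Function.update_of_ne j.2, one_apply_ne]
    simpa [Equiv.piSplitAt, j.2] using hj

/-- I ⊗ M ⊗ I is block diagonal over the grid lines in direction i, so every one-dimensional form
inequality can be summed line by line. -/
theorem dotProduct_inDirection_mulVec (i : Fin d) (M : Matrix (Fin (n i)) (Fin (n i)) ℝ)
    (x y : MultiIndex n → ℝ) :
    x ⬝ᵥ inDirection i M *ᵥ y = ∑ r, fiber i x r ⬝ᵥ M *ᵥ fiber i y r := by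
  simp only [dotProduct, mulVec, Finset.mul_sum]
  rw [← Equiv.sum_comp (Equiv.piSplitAt i fun j => Fin (n j)).symm, Fintype.sum_prod_type,
    Finset.sum_comm]
  refine Finset.sum_congr rfl fun r _ => Finset.sum_congr rfl fun a _ => ?_
  rw [← Equiv.sum_comp (Equiv.piSplitAt i fun j => Fin (n j)).symm, Fintype.sum_prod_type]
  refine Finset.sum_congr rfl fun b _ => ?_
  simp only [inDirection_apply_piSplitAt_symm]
  rw [Finset.sum_eq_single r]
  · simp [fiber]
  · intro s _ hs
    simp [hs.symm]
  · simp

/-- Reversal of every coordinate of a multi-index. -/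
def multiRev (n : Fin d → ℕ) : Equiv.Perm (MultiIndex n) :=
  Equiv.piCongrRight fun _ => Fin.revPerm

theorem multiRev_apply (p : MultiIndex n) (i : Fin d) : multiRev n p i = (p i).rev := rfl

theorem multiRev_multiRev (p : MultiIndex n) : multiRev n (multiRev n p) = p := by
  ext i
  simp [multiRev_apply]

theorem multilevelExchange_apply (p q : MultiIndex n) :
    multilevelExchange n p q = if q = multiRev n p then 1 else 0 := by
  have h : ∀ i, ((p i : ℕ) + q i + 1 = n i) ↔ q i = multiRev n p i := fun i => by
    rw [multiRev_apply, Fin.ext_iff, Fin.val_rev]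
    omega
  simp only [multilevelExchange, kroneckerProd, exchangeMatrix, of_apply, h]
  rw [Finset.prod_ite_zero]
  simp [funext_iff]

theorem multilevelExchange_mulVec (x : MultiIndex n → ℝ) :
    multilevelExchange n *ᵥ x = x ∘ multiRev n := by
  ext p
  simp [mulVec, dotProduct, multilevelExchange_apply]

theorem inDirection_multiRev {i : Fin d} {M N : Matrix (Fin (n i)) (Fin (n i)) ℝ}
    (h : ∀ a b, M a.rev b.rev = N a b) (p q : MultiIndex n) :
    inDirection i M (multiRev n p) (multiRev n q) = inDirection i N p q := by
  simp only [inDirection, kroneckerProd, of_apply]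
  refine Finset.prod_congr rfl fun j _ => ?_
  rcases eq_or_ne j i with rfl | hj
  · simp [multiRev_apply, h]
  · simp [hj, multiRev_apply, one_apply]

theorem inDirection_transpose (i : Fin d) (M : Matrix (Fin (n i)) (Fin (n i)) ℝ) :
    (inDirection i M)ᵀ = inDirection i Mᵀ := by
  ext p q
  simp only [inDirection, kroneckerProd, of_apply, transpose_apply]
  refine Finset.prod_congr rfl fun j _ => ?_
  rcases eq_or_ne j i with rfl | hj
  · simp
  · simp [hj, one_apply, eq_comm]

variable {α dp dm a b : Fin d → ℝ} {δ : ℝ}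

theorem coeffMatrix_multiRev (p q : MultiIndex n) :
    coeffMatrix α dp dm a b n δ (multiRev n p) (multiRev n q) =
      coeffMatrix α dp dm a b n δ q p := by
  simp only [coeffMatrix, Matrix.add_apply, Matrix.smul_apply, Matrix.sum_apply, transpose_apply]
  have h : ∀ i, ∀ p q : MultiIndex n,
      inDirection i (grunwaldMatrix (α i) (n i)) (multiRev n p) (multiRev n q) =
        inDirection i (grunwaldMatrix (α i) (n i)) q p := fun i p q => by
    rw [inDirection_multiRev (N := (grunwaldMatrix (α i) (n i))ᵀ)
      (fun a b => grunwaldMatrix_rev _ a b), ← inDirection_transpose, transpose_apply]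
  simp only [h, one_apply, EmbeddingLike.apply_eq_iff_eq, eq_comm]

theorem tauPreconditioner_multiRev (p q : MultiIndex n) :
    tauPreconditioner α dp dm a b n δ (multiRev n p) (multiRev n q) =
      tauPreconditioner α dp dm a b n δ p q := by
  simp only [tauPreconditioner, Matrix.add_apply, Matrix.smul_apply, Matrix.sum_apply]
  simp only [inDirection_multiRev (fun a b => tauMatrix_rev _ a b), one_apply,
    EmbeddingLike.apply_eq_iff_eq]

theorem tauPreconditioner_transpose :
    (tauPreconditioner α dp dm a b n δ)ᵀ = tauPreconditioner α dp dm a b n δ := by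
  rw [tauPreconditioner, transpose_add, transpose_smul, transpose_one, transpose_sum]
  congr 1
  refine Finset.sum_congr rfl fun i _ => ?_
  rw [transpose_smul, inDirection_transpose]
  congr 2
  ext j k
  exact tauMatrix_symPart_apply_comm _ k j

theorem dotProduct_coeffMatrix_mulVec (x y : MultiIndex n → ℝ) :
    x ⬝ᵥ coeffMatrix α dp dm a b n δ *ᵥ y = 1 / δ * (x ⬝ᵥ y) +
      ∑ i, (scaledCoeff α dp a b n i * (x ⬝ᵥ inDirection i (grunwaldMatrix (α i) (n i)) *ᵥ y) +
        scaledCoeff α dm a b n i * (y ⬝ᵥ inDirection i (grunwaldMatrix (α i) (n i)) *ᵥ x)) := by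
  rw [coeffMatrix, add_mulVec, dotProduct_add, smul_mulVec, one_mulVec, dotProduct_smul,
    smul_eq_mul, sum_mulVec, dotProduct_sum]
  simp only [add_mulVec, dotProduct_add, smul_mulVec, dotProduct_smul, smul_eq_mul,
    dotProduct_transpose_mulVec_comm]

theorem dotProduct_tauPreconditioner_mulVec (x y : MultiIndex n → ℝ) :
    x ⬝ᵥ tauPreconditioner α dp dm a b n δ *ᵥ y = 1 / δ * (x ⬝ᵥ y) +
      ∑ i, (scaledCoeff α dp a b n i + scaledCoeff α dm a b n i) *
        (x ⬝ᵥ inDirection i (tauMatrix (symPart (grunwaldMatrix (α i) (n i)))) *ᵥ y) := by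
  rw [tauPreconditioner, add_mulVec, dotProduct_add, smul_mulVec, one_mulVec, dotProduct_smul,
    smul_eq_mul, sum_mulVec, dotProduct_sum]
  simp only [smul_mulVec, dotProduct_smul, smul_eq_mul]

theorem dotProduct_inDirection_tauMatrix_le {i : Fin d} {β : ℝ} (h1 : 1 < β) (h2 : β < 2)
    (x : MultiIndex n → ℝ) :
    x ⬝ᵥ inDirection i (tauMatrix (symPart (grunwaldMatrix β (n i)))) *ᵥ x ≤
      2 * (x ⬝ᵥ inDirection i (grunwaldMatrix β (n i)) *ᵥ x) := by
  rw [dotProduct_inDirection_mulVec, dotProduct_inDirection_mulVec, Finset.mul_sum]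
  refine Finset.sum_le_sum fun r _ => (tauMatrix_le_two_mul h1 h2 _).trans_eq ?_
  rw [dotProduct_symPart_mulVec]
  ring

theorem two_mul_dotProduct_inDirection_le {i : Fin d} {β : ℝ} (h1 : 1 < β) (h2 : β < 2)
    (x : MultiIndex n → ℝ) :
    2 * (x ⬝ᵥ inDirection i (grunwaldMatrix β (n i)) *ᵥ x) ≤
      3 * (x ⬝ᵥ inDirection i (tauMatrix (symPart (grunwaldMatrix β (n i)))) *ᵥ x) := by
  rw [dotProduct_inDirection_mulVec, dotProduct_inDirection_mulVec, Finset.mul_sum, Finset.mul_sum]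
  refine Finset.sum_le_sum fun r _ => (two_mul_le_three_mul_tauMatrix h1 h2 _).trans_eq' ?_
  rw [dotProduct_symPart_mulVec]
  ring

theorem inDirection_grunwaldMatrix_sector {i : Fin d} {β : ℝ} (h1 : 1 < β) (h2 : β < 2)
    (x y : MultiIndex n → ℝ) :
    |x ⬝ᵥ inDirection i (grunwaldMatrix β (n i)) *ᵥ y -
        y ⬝ᵥ inDirection i (grunwaldMatrix β (n i)) *ᵥ x| ≤
      |Real.tan (β / 2 * Real.pi)| * (x ⬝ᵥ inDirection i (grunwaldMatrix β (n i)) *ᵥ x +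
        y ⬝ᵥ inDirection i (grunwaldMatrix β (n i)) *ᵥ y) := by
  simp only [dotProduct_inDirection_mulVec]
  rw [← Finset.sum_sub_distrib, ← Finset.sum_add_distrib, Finset.mul_sum]
  exact (Finset.abs_sum_le_sum_abs _ _).trans
    (Finset.sum_le_sum fun r _ => grunwaldMatrix_sector h1 h2 _ _)

theorem scaledCoeff_eq (c : Fin d → ℝ) (i : Fin d) :
    scaledCoeff α c a b n i = c i * (2 * stepSize a b n i ^ α i)⁻¹ := div_eq_mul_inv _ _

theorem stepSize_pos (hab : ∀ i, a i < b i) (i : Fin d) : 0 < stepSize a b n i :=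
  div_pos (sub_pos.2 (hab i)) (by positivity)

theorem scaledCoeff_add_nonneg (hdp : ∀ i, 0 ≤ dp i) (hdm : ∀ i, 0 ≤ dm i)
    (hab : ∀ i, a i < b i) (i : Fin d) :
    0 ≤ scaledCoeff α dp a b n i + scaledCoeff α dm a b n i := by
  have := stepSize_pos (n := n) hab i
  have := hdp i
  have := hdm i
  rw [scaledCoeff_eq, scaledCoeff_eq]
  positivity

theorem epsBound_nonneg [NeZero d] (hd : ∀ i, 0 < dp i + dm i) : 0 ≤ epsBound α dp dm := by
  refine le_trans ?_ (Finset.le_sup' _ (Finset.mem_univ (0 : Fin d)))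
  have := hd 0
  positivity

/-- Both scaled coefficients carry the same factor 1/(2h_i^{α_i}), which cancels; this is why the
constant is independent of the mesh. -/
theorem abs_scaledCoeff_sub_mul_le [NeZero d] (hd : ∀ i, 0 < dp i + dm i)
    (hab : ∀ i, a i < b i) (i : Fin d) :
    |scaledCoeff α dp a b n i - scaledCoeff α dm a b n i| * |Real.tan (α i / 2 * Real.pi)| ≤
      epsBound α dp dm * (scaledCoeff α dp a b n i + scaledCoeff α dm a b n i) := by
  have h := Finset.le_sup' (fun i : Fin d =>
    |dp i - dm i| / (dp i + dm i) * |Real.tan (α i / 2 * Real.pi)|) (Finset.mem_univ i)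
  have hs : 0 < (2 * stepSize a b n i ^ α i)⁻¹ := by
    have := stepSize_pos (n := n) hab i
    positivity
  rw [scaledCoeff_eq, scaledCoeff_eq, ← sub_mul, ← add_mul, abs_mul, abs_of_pos hs, mul_right_comm,
    ← mul_assoc]
  refine mul_le_mul_of_nonneg_right ?_ hs.le
  rwa [div_mul_eq_mul_div, div_le_iff₀ (hd i)] at h

theorem dotProduct_self_nonneg {ι : Type*} [Fintype ι] (x : ι → ℝ) : 0 ≤ x ⬝ᵥ x :=
  Finset.sum_nonneg fun i _ => mul_self_nonneg (x i)

theorem dotProduct_self_pos {ι : Type*} [Fintype ι] {x : ι → ℝ} (hx : x ≠ 0) : 0 < x ⬝ᵥ x :=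
  (dotProduct_self_nonneg x).lt_of_ne' (mt dotProduct_self_eq_zero.1 hx)

theorem dotProduct_tauPreconditioner_mulVec_pos (hα : ∀ i, 1 < α i ∧ α i < 2)
    (hdp : ∀ i, 0 ≤ dp i) (hdm : ∀ i, 0 ≤ dm i) (hab : ∀ i, a i < b i) (hδ : 0 < δ)
    {x : MultiIndex n → ℝ} (hx : x ≠ 0) : 0 < x ⬝ᵥ tauPreconditioner α dp dm a b n δ *ᵥ x := by
  rw [dotProduct_tauPreconditioner_mulVec]
  refine add_pos_of_pos_of_nonneg (mul_pos (by positivity) (dotProduct_self_pos hx))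
    (Finset.sum_nonneg fun i _ => mul_nonneg (scaledCoeff_add_nonneg hdp hdm hab i) ?_)
  -- Chaining the two comparisons gives q ≤ 3q for the τ-form q, hence q ≥ 0.
  have h1 := dotProduct_inDirection_tauMatrix_le (i := i) (hα i).1 (hα i).2 x
  have h2 := two_mul_dotProduct_inDirection_le (i := i) (hα i).1 (hα i).2 x
  linarith

/-- The term (1/δ)I makes the inequality strict; the directional terms only give ≤. -/
theorem dotProduct_tauPreconditioner_mulVec_lt (hα : ∀ i, 1 < α i ∧ α i < 2)
    (hdp : ∀ i, 0 ≤ dp i) (hdm : ∀ i, 0 ≤ dm i) (hab : ∀ i, a i < b i) (hδ : 0 < δ)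
    {x : MultiIndex n → ℝ} (hx : x ≠ 0) :
    x ⬝ᵥ tauPreconditioner α dp dm a b n δ *ᵥ x <
      2 * (x ⬝ᵥ coeffMatrix α dp dm a b n δ *ᵥ x) := by
  rw [dotProduct_tauPreconditioner_mulVec, dotProduct_coeffMatrix_mulVec, mul_add, Finset.mul_sum]
  have hx' : 0 < 1 / δ * (x ⬝ᵥ x) := mul_pos (by positivity) (dotProduct_self_pos hx)
  refine add_lt_add_of_lt_of_le (by linarith) (Finset.sum_le_sum fun i _ => ?_)
  have := mul_le_mul_of_nonneg_left
    (dotProduct_inDirection_tauMatrix_le (i := i) (hα i).1 (hα i).2 x)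
    (scaledCoeff_add_nonneg (α := α) (n := n) hdp hdm hab i)
  linarith

theorem two_mul_dotProduct_coeffMatrix_mulVec_lt (hα : ∀ i, 1 < α i ∧ α i < 2)
    (hdp : ∀ i, 0 ≤ dp i) (hdm : ∀ i, 0 ≤ dm i) (hab : ∀ i, a i < b i) (hδ : 0 < δ)
    {x : MultiIndex n → ℝ} (hx : x ≠ 0) :
    2 * (x ⬝ᵥ coeffMatrix α dp dm a b n δ *ᵥ x) <
      3 * (x ⬝ᵥ tauPreconditioner α dp dm a b n δ *ᵥ x) := by
  rw [dotProduct_tauPreconditioner_mulVec, dotProduct_coeffMatrix_mulVec, mul_add, mul_add,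
    Finset.mul_sum, Finset.mul_sum]
  have hx' : 0 < 1 / δ * (x ⬝ᵥ x) := mul_pos (by positivity) (dotProduct_self_pos hx)
  refine add_lt_add_of_lt_of_le (by linarith) (Finset.sum_le_sum fun i _ => ?_)
  have := mul_le_mul_of_nonneg_left
    (two_mul_dotProduct_inDirection_le (i := i) (hα i).1 (hα i).2 x)
    (scaledCoeff_add_nonneg (α := α) (n := n) hdp hdm hab i)
  linarith

/-- In direction i the skew part carries v_{i,+} - v_{i,-} and the symmetric part v_{i,+} + v_{i,-},
so the one-dimensional sector constant is multiplied by their ratio. The term (1/δ)I only enlarges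
the symmetric part. -/
theorem coeffMatrix_sector [NeZero d] (hα : ∀ i, 1 < α i ∧ α i < 2)
    (hd : ∀ i, 0 < dp i + dm i) (hab : ∀ i, a i < b i) (hδ : 0 < δ) (x y : MultiIndex n → ℝ) :
    |x ⬝ᵥ coeffMatrix α dp dm a b n δ *ᵥ y - y ⬝ᵥ coeffMatrix α dp dm a b n δ *ᵥ x| ≤
      epsBound α dp dm * (x ⬝ᵥ coeffMatrix α dp dm a b n δ *ᵥ x +
        y ⬝ᵥ coeffMatrix α dp dm a b n δ *ᵥ y) := by
  have hself : ∀ x : MultiIndex n → ℝ, 0 ≤ 1 / δ * (x ⬝ᵥ x) := fun x =>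
    mul_nonneg (by positivity) (dotProduct_self_nonneg x)
  have hx := hself x
  have hy := hself y
  simp only [dotProduct_coeffMatrix_mulVec]
  rw [dotProduct_comm y x, add_sub_add_left_eq_sub, ← Finset.sum_sub_distrib]
  refine (Finset.abs_sum_le_sum_abs _ _).trans ?_
  have hsum : ∀ i, |scaledCoeff α dp a b n i *
        (x ⬝ᵥ inDirection i (grunwaldMatrix (α i) (n i)) *ᵥ y) +
      scaledCoeff α dm a b n i * (y ⬝ᵥ inDirection i (grunwaldMatrix (α i) (n i)) *ᵥ x) -
      (scaledCoeff α dp a b n i * (y ⬝ᵥ inDirection i (grunwaldMatrix (α i) (n i)) *ᵥ x) +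
      scaledCoeff α dm a b n i * (x ⬝ᵥ inDirection i (grunwaldMatrix (α i) (n i)) *ᵥ y))| ≤
      epsBound α dp dm * ((scaledCoeff α dp a b n i + scaledCoeff α dm a b n i) *
        (x ⬝ᵥ inDirection i (grunwaldMatrix (α i) (n i)) *ᵥ x +
          y ⬝ᵥ inDirection i (grunwaldMatrix (α i) (n i)) *ᵥ y)) := fun i => by
    set W := inDirection i (grunwaldMatrix (α i) (n i))
    have e : scaledCoeff α dp a b n i * (x ⬝ᵥ W *ᵥ y) + scaledCoeff α dm a b n i * (y ⬝ᵥ W *ᵥ x) -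
        (scaledCoeff α dp a b n i * (y ⬝ᵥ W *ᵥ x) + scaledCoeff α dm a b n i * (x ⬝ᵥ W *ᵥ y)) =
        (scaledCoeff α dp a b n i - scaledCoeff α dm a b n i) *
          (x ⬝ᵥ W *ᵥ y - y ⬝ᵥ W *ᵥ x) := by ring
    have hW : ∀ x : MultiIndex n → ℝ, 0 ≤ x ⬝ᵥ W *ᵥ x := fun x => by
      have h1 := dotProduct_inDirection_tauMatrix_le (i := i) (hα i).1 (hα i).2 x
      have h2 := two_mul_dotProduct_inDirection_le (i := i) (hα i).1 (hα i).2 x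
      linarith
    rw [e, abs_mul, ← mul_assoc]
    refine (mul_le_mul_of_nonneg_left
      (inDirection_grunwaldMatrix_sector (hα i).1 (hα i).2 x y) (abs_nonneg _)).trans ?_
    rw [← mul_assoc]
    exact mul_le_mul_of_nonneg_right (abs_scaledCoeff_sub_mul_le hd hab i)
      (add_nonneg (hW x) (hW y))
  refine (Finset.sum_le_sum fun i _ => hsum i).trans ?_
  rw [← Finset.mul_sum]
  refine mul_le_mul_of_nonneg_left ?_ (epsBound_nonneg hd)
  rw [add_add_add_comm, ← Finset.sum_add_distrib]
  refine le_trans (le_of_eq (Finset.sum_congr rfl fun i _ => ?_))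
    (le_add_of_nonneg_left (add_nonneg hx hy))
  ring

theorem eigenvaluesIn_preconditionedMatrix [NeZero d] (hα : ∀ i, 1 < α i ∧ α i < 2)
    (hdp : ∀ i, 0 ≤ dp i) (hdm : ∀ i, 0 ≤ dm i) (hd : ∀ i, 0 < dp i + dm i)
    (hab : ∀ i, a i < b i) (hδ : 0 < δ) :
    EigenvaluesIn (preconditionedMatrix α dp dm a b n δ)
      (spectralSet (Real.sqrt (1 + epsBound α dp dm ^ 2) - 1)) :=
  eigenvaluesIn_spectralSet (epsBound_nonneg hd) (multiRev n) multiRev_multiRev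
    multilevelExchange_mulVec coeffMatrix_multiRev tauPreconditioner_multiRev
    tauPreconditioner_transpose
    (fun _ => dotProduct_tauPreconditioner_mulVec_pos hα hdp hdm hab hδ)
    (fun _ => dotProduct_tauPreconditioner_mulVec_lt hα hdp hdm hab hδ)
    (fun _ => two_mul_dotProduct_coeffMatrix_mulVec_lt hα hdp hdm hab hδ)
    (coeffMatrix_sector hα hd hab hδ)

end FracTau

/-! ### The choice ε = √(1 + μ²) - 1 -/

theorem mainTheorem1 {d : ℕ} [NeZero d] (α dp dm : Fin d → ℝ)
    (hα : ∀ i, 1 < α i ∧ α i < 2)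
    (hdp : ∀ i, 0 ≤ dp i) (hdm : ∀ i, 0 ≤ dm i) (hd : ∀ i, 0 < dp i + dm i) :
    (∀ (a b : Fin d → ℝ) (n : Fin d → ℕ) (δ : ℝ),
      (∀ i, a i < b i) → (∀ i, 0 < n i) → 0 < δ →
        IsUnit (FracTau.tauPreconditioner α dp dm a b n δ) ∧
        ∃ ε < FracTau.epsBound α dp dm,
          FracTau.EigenvaluesIn (FracTau.preconditionedMatrix α dp dm a b n δ)
            (FracTau.spectralSet ε)) ∧
    (∃ ε : ℝ, 0 ≤ ε ∧ ε ≤ FracTau.epsBound α dp dm ∧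
      (0 < FracTau.epsBound α dp dm → ε < FracTau.epsBound α dp dm) ∧
      ∀ (a b : Fin d → ℝ) (n : Fin d → ℕ) (δ : ℝ),
        (∀ i, a i < b i) → (∀ i, 0 < n i) → 0 < δ →
          FracTau.EigenvaluesIn (FracTau.preconditionedMatrix α dp dm a b n δ)
            (FracTau.spectralSet ε)) := by
  set μ := FracTau.epsBound α dp dm
  have hμ : 0 ≤ μ := FracTau.epsBound_nonneg hd
  -- 1 + μ² ≤ (1 + μ)², with strict inequality exactly when μ > 0.
  have hle : Real.sqrt (1 + μ ^ 2) - 1 ≤ μ := by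
    rw [sub_le_iff_le_add]
    exact Real.sqrt_le_iff.2 ⟨by positivity, by nlinarith⟩
  refine ⟨fun a b n δ hab _ hδ => ⟨?_, ?_⟩, Real.sqrt (1 + μ ^ 2) - 1, ?_, hle, fun hμ' => ?_,
    fun a b n δ hab _ hδ =>
      FracTau.eigenvaluesIn_preconditionedMatrix hα hdp hdm hd hab hδ⟩
  · exact FracTau.isUnit_of_dotProduct_mulVec_pos fun _ =>
      FracTau.dotProduct_tauPreconditioner_mulVec_pos hα hdp hdm hab hδ
  · obtain ⟨ε, hε, h⟩ :=
      (FracTau.eigenvaluesIn_preconditionedMatrix (n := n) hα hdp hdm hd hab hδ).exists_lt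
    exact ⟨ε, hε.trans_le hle, h⟩
  · rw [sub_nonneg, Real.one_le_sqrt]
    nlinarith
  · rw [sub_lt_iff_lt_add]
    exact (Real.sqrt_lt' (by positivity)).2 (by nlinarith)
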